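/- Let $T(z)=\sum_{k\ge 1} k^{k-1}\frac{z^k}{k!}$ (convergent for $|z|\le 1/e$) be the tree function. Give the edges of the complete directed graph (all ordered pairs of distinct vertices) or of the complete undirected graph on $n$ vertices i.i.d. random weights that are exponentially distributed with mean $1$. A cycle visits distinct vertices; its length is its number of edges, which is at least $2$ in the directed case and at least $3$ in the undirected case, and its mean weight is the sum of its edge weights divided by its length. The min mean-weight cycle (almost surely unique) is the cycle of smallest mean weight. Directed case. For every fixed $k\ge 2$, $$\lim_{n\to\infty}\Pr[\text{the min mean-weight cycle has length } k]=\lim_{n\to\infty}\Pr\Big[\text{the min mean-weight cycle has length } k \text{ and mean weight} \le \tfrac{1}{en}\Big]=p_k,$$ where $$p_k=\int_0^{1/e}\frac{c^{k-1}k^k}{k!}\,e^{-T(c)+c}\,dc .$$ Undirected case. For every fixed $k\ge 3$, $$\lim_{n\to\infty}\Pr[\text{the min mean-weight cycle has length } k]=\lim_{n\to\infty}\Pr\Big[\text{the min mean-weight cycle has length } k \text{ and mean weight} \le \tfrac{1}{en}\Big]=p'_k,$$ where $$p'_k=\int_0^{1/e}\frac{c^{k-1}k^k}{2\,k!}\,e^{(-T(c)+c+c^2)/2}\,dc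 .$$ Consequently both series converge and $\sum_{k\ge 2}p_k<1$ and $\sum_{k\ge 3}p'_k<1$. -/

import Mathlib

open MeasureTheory ProbabilityTheory Filter Topology

/-- The tree function `T(z) = ∑_{k ≥ 1} k^(k-1) z^k / k!`, with the summation index shifted by one
(the series converges for `|z| ≤ 1/e`). -/
noncomputable def treeFunction (z : ℝ) : ℝ :=
  ∑' j : ℕ, ((j + 1 : ℕ) : ℝ) ^ j * z ^ (j + 1) / ((j + 1).factorial : ℝ)

theorem finRotate_apply_ne {k : ℕ} (hk : 2 ≤ k) (i : Fin k) : finRotate k i ≠ i := by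
  have h : i ∈ (finRotate k).support := by
    rw [support_finRotate_of_le hk]; exact Finset.mem_univ i
  exact Equiv.Perm.mem_support.mp h

/-- The arcs of the complete directed graph on `n` vertices (no loops). -/
abbrev Arc (n : ℕ) : Type := {a : Fin n × Fin n // a.1 ≠ a.2}

/-- The edges of the complete undirected graph on `n` vertices (no loops). -/
abbrev UEdge (n : ℕ) : Type := {e : Sym2 (Fin n) // ¬ e.IsDiag}

/-- The law of i.i.d. edge weights, exponential with mean `1`, on a finite set of edges. -/
noncomputable def expWeights (E : Type) [Fintype E] : Measure (E → ℝ) :=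
  Measure.pi fun _ => expMeasure 1

/-- A cycle of the complete directed graph on `n` vertices, given by the cyclic sequence of its
distinct vertices `v₀ → v₁ → ⋯ → v_{k-1} → v₀`, where `k ≥ 2`. (The choice of the starting
vertex affects neither the length nor the weight.) -/
structure DirCycle (n : ℕ) where
  length : ℕ
  two_le : 2 ≤ length
  vert : Fin length ↪ Fin n

namespace DirCycle

variable {n : ℕ}

/-- The `i`-th arc, from a vertex to the cyclically next one. -/
def arc (C : DirCycle n) (i : Fin C.length) : Arc n :=
  ⟨(C.vert i, C.vert (finRotate C.length i)),
    fun h => finRotate_apply_ne C.two_le i (C.vert.injective h).symm⟩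

noncomputable def weight (C : DirCycle n) (w : Arc n → ℝ) : ℝ := ∑ i, w (C.arc i)

noncomputable def meanWeight (C : DirCycle n) (w : Arc n → ℝ) : ℝ := C.weight w / C.length

/-- `C` is a minimum mean-weight cycle. -/
def IsMinMean (C : DirCycle n) (w : Arc n → ℝ) : Prop :=
  ∀ C' : DirCycle n, C.meanWeight w ≤ C'.meanWeight w

end DirCycle

/-- A cycle of the complete undirected graph on `n` vertices, given by the cyclic sequence of its
distinct vertices `v₀, v₁, …, v_{k-1}`, where `k ≥ 3`. (The choice of the starting vertex and of
the orientation affects neither the length nor the weight.) -/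
structure UndirCycle (n : ℕ) where
  length : ℕ
  three_le : 3 ≤ length
  vert : Fin length ↪ Fin n

namespace UndirCycle

variable {n : ℕ}

/-- The `i`-th edge, joining a vertex to the cyclically next one. -/
def edge (C : UndirCycle n) (i : Fin C.length) : UEdge n :=
  ⟨s(C.vert i, C.vert (finRotate C.length i)),
    fun h => finRotate_apply_ne (le_trans (by norm_num) C.three_le) i
      (C.vert.injective (Sym2.mk_isDiag_iff.mp h)).symm⟩

noncomputable def weight (C : UndirCycle n) (w : UEdge n → ℝ) : ℝ := ∑ i, w (C.edge i)

noncomputable def meanWeight (C : UndirCycle n) (w : UEdge n → ℝ) : ℝ := C.weight w / C.length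

/-- `C` is a minimum mean-weight cycle. -/
def IsMinMean (C : UndirCycle n) (w : UEdge n → ℝ) : Prop :=
  ∀ C' : UndirCycle n, C.meanWeight w ≤ C'.meanWeight w

end UndirCycle

/-- The limiting probability of length `k ≥ 2` for the complete directed graph. -/
noncomputable def pDir (k : ℕ) : ℝ :=
  ∫ c in (0 : ℝ)..(1 / Real.exp 1),
    c ^ (k - 1) * (k : ℝ) ^ k / (k.factorial : ℝ) * Real.exp (-treeFunction c + c)

/-- The limiting probability of length `k ≥ 3` for the complete undirected graph. -/
noncomputable def pUndir (k : ℕ) : ℝ :=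
  ∫ c in (0 : ℝ)..(1 / Real.exp 1),
    c ^ (k - 1) * (k : ℝ) ^ k / (2 * (k.factorial : ℝ)) *
      Real.exp ((-treeFunction c + c + c ^ 2) / 2)

/-! ### Poisson approximation for weakly dependent events -/

section Avoidance

variable {Ω ι : Type*} [MeasurableSpace Ω]

/-! Say that a cycle has level `c` if its mean weight is `c / n`. There are about `n ^ k / (m * k)`
cycles of length `k`, with `m = 1` for directed and `m = 2` for undirected graphs. Each has level at
most `c` with probability about `(k * c / n) ^ k / k!`, so the expected number of such cycles tends
to `rate m k c`. Edge-disjoint cycles are independent. Two distinct short cycles sharing an edge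
span more edges than vertices, so such pairs contribute only `O(1 / n)` (`sum_pairs_le`). Hence, for
lengths up to a fixed `L` and thresholds depending on the length, the probability that no cycle is
below its threshold tends to the exponential of minus the sum of the rates (`tendsto_real_avoid`).

As the level rises from `0`, the minimum has length `k` and level in `dc` with limiting density
`rateDeriv m k c` times the exponential of minus the sum of the rates at `c`. Discretising the level
turns this into Riemann–Stieltjes sums of differences of avoidance probabilities. Summed over all
admissible lengths, the rates form the tree series without its first terms, divided by `m`; this
produces the stated integrands.

Stirling's formula makes `1 / e` critical. At that level the rates are `O(k ^ (-3/2))`, so cycles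
longer than `L` are excluded up to a small first-moment tail; this bounds from below the probability
of the event restricted to mean weight at most `1 / (e n)`. At any level `b > 1 / e` the rates
diverge, so for large `L` a cycle of length at most `L` below level `b` is nearly certain. The
window from `1 / e` to `b` contributes little for the fixed `k`. This bounds the unrestricted event
from above by the same limit, and both limits follow.

With finitely many lengths the integrands sum to the derivative of `-exp (-rateSum)`. Hence the
limits sum to at most `1 - exp (-rateTotal m l (1 / e))`, which is below `1` because the total rate
at `1 / e` is finite. -/

theorem Real.abs_one_sub_sub_exp_neg_le {p : ℝ} (h0 : 0 ≤ p) (h1 : p ≤ 1) :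
    |1 - p - Real.exp (-p)| ≤ p ^ 2 := by
  have := Real.abs_exp_sub_one_sub_id_le (x := -p) (by rwa [abs_neg, abs_of_nonneg h0])
  rw [abs_sub_comm]
  have e : Real.exp (-p) - (1 - p) = Real.exp (-p) - 1 - -p := by ring
  rwa [e, ← neg_sq p]

/-- Poisson approximation of the probability that none of finitely many events occurs, when each
event is independent of the events that are not related to it. -/
theorem abs_measureReal_iInter_compl_sub_exp_le [DecidableEq ι] (μ : Measure Ω)
    [IsProbabilityMeasure μ] (A : ι → Set Ω) (hA : ∀ i, MeasurableSet (A i))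
    (R : ι → ι → Prop) [DecidableRel R]
    (hind : ∀ (i : ι) (U : Finset ι), (∀ j ∈ U, ¬ R i j) →
      μ.real (A i ∩ ⋂ j ∈ U, (A j)ᶜ) = μ.real (A i) * μ.real (⋂ j ∈ U, (A j)ᶜ))
    (T : Finset ι) :
    |μ.real (⋂ j ∈ T, (A j)ᶜ) - Real.exp (-∑ j ∈ T, μ.real (A j))| ≤
      ∑ i ∈ T, μ.real (A i) ^ 2 +
      ∑ i ∈ T, ∑ j ∈ T with j ≠ i ∧ R i j,
        (μ.real (A i ∩ A j) + μ.real (A i) * μ.real (A j)) := by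
  induction T using Finset.induction_on with
  | empty => simp
  | insert a T ha ih =>
    set p := μ.real (A a) with hp
    have hp0 : 0 ≤ p := measureReal_nonneg
    have hp1 : p ≤ 1 := measureReal_le_one
    set P := μ.real (⋂ j ∈ T, (A j)ᶜ) with hP
    set s := ∑ j ∈ T, μ.real (A j) with hs
    have hs0 : 0 ≤ s := Finset.sum_nonneg fun _ _ => measureReal_nonneg
    -- Independence from `A a` holds only for the unrelated events `F`. Passing between `F` and `T`
    -- costs a union bound over the related events `N`.
    set N := T.filter (R a) with hN
    set F := T.filter (fun j => ¬ R a j) with hF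
    have hsplit : (⋂ j ∈ T, (A j)ᶜ) = (⋂ j ∈ F, (A j)ᶜ) \ ⋃ j ∈ N, A j := by
      ext x
      simp only [Set.mem_iInter, Set.mem_sdiff, Set.mem_iUnion, Set.mem_compl_iff, hN, hF,
        Finset.mem_filter, not_exists]
      grind
    have hins : μ.real (⋂ j ∈ insert a T, (A j)ᶜ) = P - μ.real (A a ∩ ⋂ j ∈ T, (A j)ᶜ) := by
      rw [Finset.set_biInter_insert, Set.inter_comm, ← Set.sdiff_eq, Set.inter_comm (A a)]
      have := measureReal_sdiff_add_inter (μ := μ) (s := ⋂ j ∈ T, (A j)ᶜ) (hA a)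
      linarith
    have hFP : |μ.real (⋂ j ∈ F, (A j)ᶜ) - P| ≤ ∑ j ∈ N, μ.real (A j) := by
      have hle : P ≤ μ.real (⋂ j ∈ F, (A j)ᶜ) := by
        rw [hP, hsplit]; exact measureReal_mono Set.sdiff_subset
      have hle2 : μ.real (⋂ j ∈ F, (A j)ᶜ) ≤ P + ∑ j ∈ N, μ.real (A j) := by
        calc μ.real (⋂ j ∈ F, (A j)ᶜ) ≤ μ.real ((⋂ j ∈ T, (A j)ᶜ) ∪ ⋃ j ∈ N, A j) := by
              refine measureReal_mono ?_
              rw [hsplit, Set.sdiff_union_self]; exact Set.subset_union_left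
          _ ≤ P + μ.real (⋃ j ∈ N, A j) := measureReal_union_le _ _
          _ ≤ _ := by gcongr; exact measureReal_biUnion_finset_le _ _
      rw [abs_of_nonneg (by linarith)]; linarith
    have hFA : |μ.real (A a ∩ ⋂ j ∈ F, (A j)ᶜ) - μ.real (A a ∩ ⋂ j ∈ T, (A j)ᶜ)| ≤
        ∑ j ∈ N, μ.real (A a ∩ A j) := by
      have hle : μ.real (A a ∩ ⋂ j ∈ T, (A j)ᶜ) ≤ μ.real (A a ∩ ⋂ j ∈ F, (A j)ᶜ) := by
        rw [hsplit]; exact measureReal_mono (Set.inter_subset_inter_right _ Set.sdiff_subset)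
      have hle2 : μ.real (A a ∩ ⋂ j ∈ F, (A j)ᶜ) ≤
          μ.real (A a ∩ ⋂ j ∈ T, (A j)ᶜ) + ∑ j ∈ N, μ.real (A a ∩ A j) := by
        calc _ ≤ μ.real ((A a ∩ ⋂ j ∈ T, (A j)ᶜ) ∪ ⋃ j ∈ N, (A a ∩ A j)) := by
              refine measureReal_mono ?_
              rw [hsplit, ← Set.inter_iUnion₂, ← Set.inter_union_distrib_left, Set.sdiff_union_self]
              exact Set.inter_subset_inter_right _ Set.subset_union_left
          _ ≤ μ.real (A a ∩ ⋂ j ∈ T, (A j)ᶜ) + μ.real (⋃ j ∈ N, (A a ∩ A j)) :=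
              measureReal_union_le _ _
          _ ≤ _ := by gcongr; exact measureReal_biUnion_finset_le _ _
      rw [abs_of_nonneg (by linarith)]; linarith
    have hindF := hind a F (fun j hj => (Finset.mem_filter.mp hj).2)
    rw [← hp] at hindF
    have key : |μ.real (⋂ j ∈ insert a T, (A j)ᶜ) - (1 - p) * P| ≤
        ∑ j ∈ N, (μ.real (A a ∩ A j) + p * μ.real (A j)) := by
      have e : μ.real (⋂ j ∈ insert a T, (A j)ᶜ) - (1 - p) * P =
          (μ.real (A a ∩ ⋂ j ∈ F, (A j)ᶜ) - μ.real (A a ∩ ⋂ j ∈ T, (A j)ᶜ)) -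
          p * (μ.real (⋂ j ∈ F, (A j)ᶜ) - P) := by
        rw [hins, hindF]; ring
      rw [e, Finset.sum_add_distrib, ← Finset.mul_sum]
      refine (abs_sub _ _).trans (add_le_add hFA ?_)
      rw [abs_mul, abs_of_nonneg hp0]
      exact mul_le_mul_of_nonneg_left hFP hp0
    -- The inherited error is multiplied by `1 - p ≤ 1`, so errors add up without amplification
    -- along the induction.
    have key2 : |(1 - p) * P - Real.exp (-(p + s))| ≤
        |P - Real.exp (-s)| + p ^ 2 := by
      have e : (1 - p) * P - Real.exp (-(p + s)) =
          (1 - p) * (P - Real.exp (-s)) + Real.exp (-s) * (1 - p - Real.exp (-p)) := by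
        rw [neg_add, Real.exp_add]; ring
      rw [e]
      refine (abs_add_le _ _).trans (add_le_add ?_ ?_)
      · rw [abs_mul, abs_of_nonneg (by linarith : 0 ≤ 1 - p)]
        exact mul_le_of_le_one_left (abs_nonneg _) (by linarith)
      · rw [abs_mul, abs_of_pos (Real.exp_pos _)]
        calc _ ≤ 1 * p ^ 2 := by
              gcongr
              · exact Real.exp_le_one_iff.mpr (by linarith)
              · exact Real.abs_one_sub_sub_exp_neg_le hp0 hp1
          _ = p ^ 2 := one_mul _
    rw [Finset.sum_insert ha, Finset.sum_insert ha, Finset.sum_insert ha, ← hp, ← hs]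
    have hfa : (insert a T).filter (fun j => j ≠ a ∧ R a j) = N := by
      ext j; simp only [hN, Finset.mem_filter, Finset.mem_insert]; grind
    rw [hfa]
    have hmono : ∑ i ∈ T, ∑ j ∈ T with j ≠ i ∧ R i j,
        (μ.real (A i ∩ A j) + μ.real (A i) * μ.real (A j)) ≤
        ∑ i ∈ T, ∑ j ∈ insert a T with j ≠ i ∧ R i j,
        (μ.real (A i ∩ A j) + μ.real (A i) * μ.real (A j)) := by
      refine Finset.sum_le_sum fun i _ => Finset.sum_le_sum_of_subset_of_nonneg ?_ ?_
      · exact Finset.filter_subset_filter _ (Finset.subset_insert _ _)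
      · intros; positivity
    have tri := abs_sub_le (μ.real (⋂ j ∈ insert a T, (A j)ᶜ)) ((1 - p) * P)
      (Real.exp (-(p + s)))
    linarith

end Avoidance

/-! ### Riemann–Stieltjes sums -/

section Riemann

/-- Left and right Riemann–Stieltjes sums of a continuous function against a continuously
differentiable one. -/
theorem exists_riemannStieltjes_sum_close {f H h : ℝ → ℝ} {b : ℝ} (hb : 0 ≤ b)
    (hf : Continuous f) (hh : Continuous h) (hH : ∀ x, HasDerivAt H (h x) x)
    (hnn : ∀ x, 0 ≤ x → 0 ≤ h x) {ε : ℝ} (hε : 0 < ε) :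
    ∃ (N : ℕ) (t : ℕ → ℝ), t 0 = 0 ∧ t N = b ∧ Monotone t ∧
      |∑ i ∈ Finset.range N, f (t i) * (H (t (i + 1)) - H (t i)) -
        ∫ x in (0 : ℝ)..b, f x * h x| ≤ ε ∧
      |∑ i ∈ Finset.range N, f (t (i + 1)) * (H (t (i + 1)) - H (t i)) -
        ∫ x in (0 : ℝ)..b, f x * h x| ≤ ε := by
  have hint : ∀ x y, ∫ u in x..y, h u = H y - H x := fun x y =>
    intervalIntegral.integral_eq_sub_of_hasDerivAt (fun u _ => hH u) (hh.intervalIntegrable _ _)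
  have hfh : ∀ x y, IntervalIntegrable (fun u => f u * h u) volume x y := fun x y =>
    (hf.mul hh).intervalIntegrable x y
  have hch : ∀ c x y, IntervalIntegrable (fun u => c * h u) volume x y := fun c x y =>
    (continuous_const.mul hh).intervalIntegrable x y
  set V := H b - H 0 with hV
  have hV0 : 0 ≤ V := by
    rw [hV, ← hint]
    exact intervalIntegral.integral_nonneg hb fun u hu => hnn u hu.1
  -- The total error is `δ * V`; the `+ 1` covers the case `V = 0`.
  set δ := ε / (V + 1) with hδ
  have hδ0 : 0 < δ := by positivity
  have huc : UniformContinuousOn f (Set.Icc 0 b) :=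
    isCompact_Icc.uniformContinuousOn_of_continuous hf.continuousOn
  obtain ⟨η, hη, hη'⟩ := Metric.uniformContinuousOn_iff.mp huc δ hδ0
  obtain ⟨N, hN⟩ := exists_nat_gt (b / η)
  have hNpos : (0 : ℝ) < N := lt_of_le_of_lt (by positivity) hN
  set t : ℕ → ℝ := fun i => b * i / N with ht
  have ht0 : t 0 = 0 := by simp [ht]
  have htN : t N = b := by simp only [ht]; field_simp
  have htm : Monotone t := by
    intro i j hij
    simp only [ht]; gcongr
  have hstep : ∀ i, t (i + 1) - t i < η := by
    intro i
    have : t (i + 1) - t i = b / N := by simp only [ht]; push_cast; ring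
    rw [this, div_lt_iff₀ hNpos]
    rw [div_lt_iff₀ hη] at hN
    linarith
  -- Arbitrary tags in the mesh intervals are allowed, so that left and right endpoints are both
  -- instances.
  have hmain : ∀ g : ℕ → ℝ, (∀ i, g i ∈ Set.Icc (t i) (t (i + 1))) →
      |∑ i ∈ Finset.range N, f (g i) * (H (t (i + 1)) - H (t i)) -
        ∫ x in (0 : ℝ)..b, f x * h x| ≤ ε := by
    intro g hg
    have hsum : ∫ x in (0 : ℝ)..b, f x * h x =
        ∑ i ∈ Finset.range N, ∫ x in (t i)..(t (i + 1)), f x * h x := by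
      rw [intervalIntegral.sum_integral_adjacent_intervals
        (fun k _ => hfh _ _), ht0, htN]
    have hsumV : V = ∑ i ∈ Finset.range N, (H (t (i + 1)) - H (t i)) := by
      rw [Finset.sum_range_sub (fun i => H (t i)), ht0, htN]
    rw [hsum, ← Finset.sum_sub_distrib]
    calc _ ≤ ∑ i ∈ Finset.range N, |f (g i) * (H (t (i + 1)) - H (t i)) -
            ∫ x in (t i)..(t (i + 1)), f x * h x| := Finset.abs_sum_le_sum_abs _ _
      _ ≤ ∑ i ∈ Finset.range N, δ * (H (t (i + 1)) - H (t i)) := by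
          refine Finset.sum_le_sum fun i hi => ?_
          have hle : t i ≤ t (i + 1) := htm (Nat.le_succ i)
          have h0i : 0 ≤ t i := ht0 ▸ htm (Nat.zero_le i)
          have hib : t (i + 1) ≤ b := htN ▸ htm (Finset.mem_range.mp hi)
          rw [← hint, ← intervalIntegral.integral_const_mul, ← intervalIntegral.integral_const_mul,
            ← intervalIntegral.integral_sub (hch _ _ _) (hfh _ _), ← Real.norm_eq_abs]
          refine (intervalIntegral.norm_integral_le_integral_norm hle).trans ?_
          refine intervalIntegral.integral_mono_on hle
            ((hch _ _ _).sub (hfh _ _)).norm (hch _ _ _) fun x hx => ?_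
          rw [← sub_mul, norm_mul, Real.norm_of_nonneg (hnn x (h0i.trans hx.1))]
          refine mul_le_mul_of_nonneg_right ?_ (hnn x (h0i.trans hx.1))
          have := hη' (g i) ⟨h0i.trans (hg i).1, (hg i).2.trans hib⟩ x
            ⟨h0i.trans hx.1, hx.2.trans hib⟩ (by
              rw [Real.dist_eq, abs_lt]
              have := hstep i
              have h1 := (hg i).1
              have h2 := (hg i).2
              have h3 := hx.1
              have h4 := hx.2
              constructor <;> linarith)
          rw [Real.dist_eq] at this
          exact this.le
      _ = δ * V := by rw [← Finset.mul_sum, ← hsumV]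
      _ ≤ ε := by
          rw [hδ, div_mul_eq_mul_div, div_le_iff₀ (by positivity)]
          nlinarith
  exact ⟨N, t, ht0, htN, htm, hmain t fun i => ⟨le_rfl, htm (Nat.le_succ i)⟩,
    hmain (fun i => t (i + 1)) fun i => ⟨htm (Nat.le_succ i), le_rfl⟩⟩

end Riemann

/-! ### Sums of independent exponential weights -/

section Weights

instance : IsProbabilityMeasure (expMeasure 1) := isProbabilityMeasure_expMeasure one_pos

variable {E : Type} [Fintype E]

instance : IsProbabilityMeasure (expWeights E) := by
  unfold expWeights; infer_instance

theorem iIndepFun_expWeights : iIndepFun (fun (e : E) (w : E → ℝ) => w e) (expWeights E) :=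
  iIndepFun_pi (X := fun _ => id) fun _ => aemeasurable_id

theorem map_eval_expWeights (e : E) :
    (expWeights E).map (fun w => w e) = expMeasure 1 :=
  (measurePreserving_eval (fun _ : E => expMeasure 1) e).map_eq

theorem lintegral_expMeasure_one {f : ℝ → ENNReal} (hf : Measurable f) :
    ∫⁻ t, f t ∂(expMeasure 1) = ∫⁻ t in Set.Ici 0, ENNReal.ofReal (Real.exp (-t)) * f t := by
  have h : expMeasure 1 = volume.withDensity (exponentialPDF 1) := rfl
  have hm : Measurable (exponentialPDF 1) := by
    unfold exponentialPDF; exact (measurable_exponentialPDFReal 1).ennreal_ofReal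
  rw [h, lintegral_withDensity_eq_lintegral_mul _ hm hf, ← lintegral_indicator measurableSet_Ici]
  refine lintegral_congr fun t => ?_
  simp only [Pi.mul_apply, Set.indicator_apply, Set.mem_Ici, exponentialPDF_eq]
  split_ifs <;> simp

theorem expMeasure_one_Iio_zero : expMeasure 1 (Set.Iio 0) = 0 := by
  rw [← lintegral_indicator_one measurableSet_Iio,
    lintegral_expMeasure_one (measurable_one.indicator measurableSet_Iio)]
  rw [setLIntegral_congr_fun (g := 0) measurableSet_Ici]
  · simp
  · intro t (ht : 0 ≤ t)
    simp [not_lt.mpr ht]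

theorem expMeasure_one_Iic_le (x : ℝ) :
    expMeasure 1 (Set.Iic x) ≤ ENNReal.ofReal x := by
  rw [← lintegral_indicator_one measurableSet_Iic,
    lintegral_expMeasure_one (measurable_one.indicator measurableSet_Iic)]
  calc _ ≤ ∫⁻ t in Set.Ici 0, (Set.Iic x).indicator 1 t := by
        refine setLIntegral_mono (measurable_one.indicator measurableSet_Iic) fun t ht => ?_
        refine mul_le_of_le_one_left (by simp) ?_
        rw [ENNReal.ofReal_le_one, Real.exp_le_one_iff]
        simpa using ht
    _ = ENNReal.ofReal x := by
        rw [lintegral_indicator_one measurableSet_Iic, Measure.restrict_apply measurableSet_Iic,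
          Set.inter_comm, Set.Ici_inter_Iic, Real.volume_Icc, sub_zero]

theorem ae_expWeights_nonneg : ∀ᵐ w ∂(expWeights E), ∀ e, 0 ≤ w e := by
  rw [ae_all_iff]
  intro e
  have h : ∀ᵐ t ∂((expWeights E).map (fun w => w e)), 0 ≤ t := by
    rw [map_eval_expWeights, ae_iff]
    simpa [Set.Iio_def] using expMeasure_one_Iio_zero
  exact ae_of_ae_map (measurable_pi_apply e).aemeasurable h

theorem expWeights_sum_le_neg (S : Finset E) {x : ℝ} (hx : x < 0) :
    expWeights E {w | ∑ e ∈ S, w e ≤ x} = 0 := by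
  refine measure_mono_null (t := {w | ¬ ∀ e, 0 ≤ w e}) (fun w hw h => ?_)
    (ae_iff.mp ae_expWeights_nonneg)
  exact absurd (Finset.sum_nonneg fun e (_ : e ∈ S) => h e) (not_le.mpr (lt_of_le_of_lt hw hx))

variable [DecidableEq E]

theorem expWeights_forall_le_le (U : Finset E) (x : ℝ) :
    expWeights E {w | ∀ e ∈ U, w e ≤ x} ≤ ENNReal.ofReal x ^ U.card := by
  have : {w : E → ℝ | ∀ e ∈ U, w e ≤ x} = Set.pi Set.univ
      (fun e => if e ∈ U then Set.Iic x else Set.univ) := by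
    ext w
    simp only [Set.mem_ofPred_eq, Set.mem_pi, Set.mem_univ, true_implies]
    refine forall_congr' fun e => ?_
    split_ifs with h <;> simp [h]
  rw [this, expWeights, Measure.pi_pi]
  calc _ ≤ ∏ e : E, if e ∈ U then ENNReal.ofReal x else 1 := by
        refine Finset.prod_le_prod' fun e _ => ?_
        split_ifs
        · exact expMeasure_one_Iic_le x
        · exact prob_le_one
    _ = _ := by rw [Finset.prod_ite_mem, Finset.univ_inter, Finset.prod_const]

/-- Condition on the weight of `a`, which is independent of the sum over `S`: a convolution with the
exponential density. -/
theorem expWeights_sum_insert {S : Finset E} {a : E} (ha : a ∉ S) (x : ℝ) :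
    expWeights E {w | ∑ e ∈ insert a S, w e ≤ x} =
      ∫⁻ t in Set.Ici 0, ENNReal.ofReal (Real.exp (-t)) *
        expWeights E {w | ∑ e ∈ S, w e ≤ x - t} := by
  have hmS : Measurable (fun w : E → ℝ => ∑ e ∈ S, w e) := by fun_prop
  have hind : IndepFun (fun w : E → ℝ => ∑ e ∈ S, w e) (fun w => w a) (expWeights E) := by
    have := (iIndepFun_expWeights (E := E)).indepFun_finsetSum_of_notMem
      (fun e => measurable_pi_apply e) ha
    convert this using 1
    ext w; simp
  have hprod := (indepFun_iff_map_prod_eq_prod_map_map hmS.aemeasurable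
    (measurable_pi_apply a).aemeasurable).mp hind
  have hset : MeasurableSet {p : ℝ × ℝ | p.1 + p.2 ≤ x} :=
    measurableSet_le (by fun_prop) (by fun_prop)
  have h1 : {w : E → ℝ | ∑ e ∈ insert a S, w e ≤ x} =
      (fun w => (∑ e ∈ S, w e, w a)) ⁻¹' {p : ℝ × ℝ | p.1 + p.2 ≤ x} := by
    ext w; simp [Finset.sum_insert ha, add_comm]
  have h2 : ∀ t, (expWeights E).map (fun w : E → ℝ => ∑ e ∈ S, w e)
      ((fun s => (s, t)) ⁻¹' {p : ℝ × ℝ | p.1 + p.2 ≤ x}) =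
        expWeights E {w | ∑ e ∈ S, w e ≤ x - t} := by
    intro t
    rw [Measure.map_apply hmS (measurable_prodMk_right hset)]
    congr 1; ext w; simp [le_sub_iff_add_le]
  have hmeas := measurable_measure_prodMk_right
    (μ := (expWeights E).map (fun w : E → ℝ => ∑ e ∈ S, w e)) hset
  rw [h1, ← Measure.map_apply (hmS.prodMk (measurable_pi_apply a)) hset, hprod,
    map_eval_expWeights, Measure.prod_apply_symm hset, lintegral_expMeasure_one hmeas]
  simp only [h2]

theorem lintegral_Icc_ofReal_sub_pow_div (n : ℕ) {x c : ℝ} (hx : 0 ≤ x) (hc : 0 ≤ c) :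
    ∫⁻ t in Set.Icc 0 x, ENNReal.ofReal (c * ((x - t) ^ n / n.factorial)) =
      ENNReal.ofReal (c * (x ^ (n + 1) / (n + 1).factorial)) := by
  rw [← ofReal_integral_eq_lintegral_ofReal]
  · congr 1
    rw [integral_Icc_eq_integral_Ioc, ← intervalIntegral.integral_of_le hx,
      intervalIntegral.integral_const_mul, intervalIntegral.integral_div,
      intervalIntegral.integral_comp_sub_left (fun u => u ^ n) x, integral_pow]
    rw [Nat.factorial_succ]; push_cast
    have : (n.factorial : ℝ) ≠ 0 := by positivity
    field_simp; simp
  · exact (Continuous.continuousOn (by fun_prop)).integrableOn_compact isCompact_Icc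
  · refine (ae_restrict_iff' measurableSet_Icc).mpr (Eventually.of_forall fun t ht => ?_)
    have : 0 ≤ x - t := by linarith [ht.2]
    simp only [Pi.zero_apply]
    positivity

theorem expWeights_sum_insert_Icc {S : Finset E} {a : E} (ha : a ∉ S) (x : ℝ) :
    expWeights E {w | ∑ e ∈ insert a S, w e ≤ x} =
      ∫⁻ t in Set.Icc 0 x, ENNReal.ofReal (Real.exp (-t)) *
        expWeights E {w | ∑ e ∈ S, w e ≤ x - t} := by
  rw [expWeights_sum_insert ha, ← lintegral_indicator measurableSet_Ici,
    ← lintegral_indicator measurableSet_Icc]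
  refine lintegral_congr fun t => ?_
  simp only [Set.indicator_apply, Set.mem_Ici, Set.mem_Icc]
  by_cases h0 : 0 ≤ t
  · by_cases h1 : t ≤ x
    · simp [h0, h1]
    · simp [h0, h1, expWeights_sum_le_neg S (show x - t < 0 by linarith)]
  · simp [h0]

/-- Induction by convolution. Bounding the density by `1` gives the volume of a simplex from above.
From below, `exp (-t) * exp (-(x - t)) = exp (-x)` carries the exponential factor through each step
unchanged. -/
theorem expWeights_sum_bounds (S : Finset E) : ∀ x : ℝ, 0 ≤ x →
    ENNReal.ofReal (Real.exp (-x) * (x ^ S.card / S.card.factorial)) ≤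
      expWeights E {w | ∑ e ∈ S, w e ≤ x} ∧
    expWeights E {w | ∑ e ∈ S, w e ≤ x} ≤ ENNReal.ofReal (x ^ S.card / S.card.factorial) := by
  induction S using Finset.induction_on with
  | empty =>
    intro x hx
    simp [hx]
  | insert a S ha ih =>
    intro x hx
    rw [expWeights_sum_insert_Icc ha, Finset.card_insert_of_notMem ha]
    constructor
    · rw [← lintegral_Icc_ofReal_sub_pow_div _ hx (Real.exp_pos _).le]
      refine setLIntegral_mono' measurableSet_Icc fun t ht => ?_
      have := (ih (x - t) (by linarith [ht.2])).1
      refine le_trans (le_of_eq ?_) (mul_le_mul_right this _)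
      rw [← ENNReal.ofReal_mul (Real.exp_pos _).le, ← mul_assoc, ← Real.exp_add]
      congr 3; ring_nf
    · have h := lintegral_Icc_ofReal_sub_pow_div S.card hx zero_le_one
      rw [one_mul] at h
      rw [← h]
      refine setLIntegral_mono' measurableSet_Icc fun t ht => ?_
      have := (ih (x - t) (by linarith [ht.2])).2
      rw [one_mul]
      refine (mul_le_of_le_one_left (by simp) ?_).trans this
      rw [ENNReal.ofReal_le_one, Real.exp_le_one_iff]
      simpa using ht.1

theorem expWeights_real_sum_le (S : Finset E) {x : ℝ} (hx : 0 ≤ x) :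
    (expWeights E).real {w | ∑ e ∈ S, w e ≤ x} ≤ x ^ S.card / S.card.factorial :=
  ENNReal.toReal_le_of_le_ofReal (by positivity) (expWeights_sum_bounds S x hx).2

theorem le_expWeights_real_sum (S : Finset E) {x : ℝ} (hx : 0 ≤ x) :
    Real.exp (-x) * (x ^ S.card / S.card.factorial) ≤
      (expWeights E).real {w | ∑ e ∈ S, w e ≤ x} :=
  (ENNReal.ofReal_le_iff_le_toReal (measure_ne_top _ _)).mp (expWeights_sum_bounds S x hx).1

/-- As weights are almost surely nonnegative, both sums being at most `x` forces every edge of `S ∪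
T` to weigh at most `x`. The factorials are lost, but only the exponent matters for overlapping
pairs. -/
theorem expWeights_real_sum_inter_sum_le (S T : Finset E) {s t x : ℝ} (hx : 0 ≤ x)
    (hs : s ≤ x) (ht : t ≤ x) :
    (expWeights E).real ({w | ∑ e ∈ S, w e ≤ s} ∩ {w | ∑ e ∈ T, w e ≤ t}) ≤
      x ^ (S ∪ T).card := by
  refine ENNReal.toReal_le_of_le_ofReal (by positivity) ?_
  rw [ENNReal.ofReal_pow hx]
  refine le_trans (measure_mono_ae ?_) (expWeights_forall_le_le (S ∪ T) x)
  filter_upwards [ae_expWeights_nonneg] with w hw hw2 e he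
  obtain ⟨h1, h2⟩ := hw2
  rcases Finset.mem_union.mp he with he | he
  · exact ((Finset.single_le_sum (fun e _ => hw e) he).trans h1).trans hs
  · exact ((Finset.single_le_sum (fun e _ => hw e) he).trans h2).trans ht

/-- Events about the weights of disjoint sets of edges are independent. -/
theorem expWeights_real_inter_iInter (S : Finset E) (U : Finset (Finset E))
    (hU : ∀ T ∈ U, Disjoint S T) (x : Finset E → ℝ) :
    (expWeights E).real ({w | ∑ e ∈ S, w e ≤ x S} ∩ ⋂ T ∈ U, {w | ∑ e ∈ T, w e ≤ x T}ᶜ) =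
    (expWeights E).real {w | ∑ e ∈ S, w e ≤ x S} *
      (expWeights E).real (⋂ T ∈ U, {w | ∑ e ∈ T, w e ≤ x T}ᶜ) := by
  have hd : Disjoint S Sᶜ := disjoint_compl_right
  have hind := (iIndepFun_expWeights (E := E)).indepFun_finset S Sᶜ hd
    (fun e => measurable_pi_apply e)
  have h1 : {w : E → ℝ | ∑ e ∈ S, w e ≤ x S} =
      (fun w (e : S) => w e) ⁻¹' {u : S → ℝ | ∑ e : S, u e ≤ x S} := by
    ext w
    simp only [Set.mem_ofPred_eq, Set.mem_preimage]
    rw [Finset.sum_coe_sort S (fun e => w e)]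
  -- Each `T` lies in `Sᶜ`, so its weight is a sum over `Sᶜ` padded by zeros, and the whole
  -- intersection depends only on the coordinates in `Sᶜ`.
  have h2 : (⋂ T ∈ U, {w : E → ℝ | ∑ e ∈ T, w e ≤ x T}ᶜ) =
      (fun w (e : (Sᶜ : Finset E)) => w e) ⁻¹'
        (⋂ T ∈ U, {u : (Sᶜ : Finset E) → ℝ | ∑ e : (Sᶜ : Finset E),
          (if (e : E) ∈ T then u e else 0) ≤ x T}ᶜ) := by
    simp only [Set.preimage_iInter]
    refine Set.iInter₂_congr fun T hT => ?_
    ext w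
    simp only [Set.mem_ofPred_eq, Set.mem_preimage, Set.mem_compl_iff]
    rw [Finset.sum_coe_sort Sᶜ (fun e => if e ∈ T then w e else 0), Finset.sum_ite_mem,
      Finset.inter_eq_right.mpr (Finset.subset_compl_iff_disjoint_right.mpr (hU T hT).symm)]
  rw [h1, h2, measureReal_def, hind.measure_inter_preimage_eq_mul, ENNReal.toReal_mul]
  · rfl
  · exact measurableSet_le (by fun_prop) (by fun_prop)
  · refine Finset.measurableSet_biInter _ fun T _ => (measurableSet_le ?_ measurable_const).compl
    refine Finset.measurable_sum _ fun e _ => ?_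
    split_ifs
    · exact measurable_pi_apply e
    · exact measurable_const

end Weights

/-! ### Combinatorics of cycles and of overlapping pairs -/

theorem card_lt_card_union_image_finRotate {k : ℕ} (hk : 2 ≤ k) {J : Finset (Fin k)}
    (hne : J.Nonempty) (huniv : J ≠ Finset.univ) :
    J.card < (J ∪ J.image (finRotate k)).card := by
  refine Finset.card_lt_card ⟨Finset.subset_union_left, fun hsub => huniv ?_⟩
  -- Without strict growth `J` is closed under the rotation; the rotation is a single cycle, so `J`
  -- would be everything.
  have hclosed : ∀ i ∈ J, finRotate k i ∈ J := fun i hi =>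
    hsub (Finset.mem_union_right _ (Finset.mem_image_of_mem _ hi))
  have hpow : ∀ m : ℕ, ∀ i ∈ J, (finRotate k ^ m) i ∈ J := by
    intro m
    induction m with
    | zero => simp
    | succ m ih =>
      intro i hi
      rw [pow_succ', Equiv.Perm.mul_apply]
      exact hclosed _ (ih i hi)
  obtain ⟨i, hi⟩ := hne
  refine Finset.eq_univ_of_forall fun j => ?_
  obtain ⟨m, rfl⟩ := (isCycle_finRotate_of_le hk).exists_pow_eq
    (finRotate_apply_ne hk i) (finRotate_apply_ne hk j)
  exact hpow m i hi

namespace DirCycle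

variable {n : ℕ} {E : Type} [DecidableEq E]

/-- The set of edges of a cycle, when every arc determines an edge. -/
def edgeSetOf (f : Arc n → E) (C : DirCycle n) : Finset E :=
  Finset.univ.image fun i => f (C.arc i)

/-- The set of vertices of a cycle. -/
def verts (C : DirCycle n) : Finset (Fin n) := Finset.univ.map C.vert

theorem card_verts (C : DirCycle n) : C.verts.card = C.length := by simp [verts]

theorem vert_mem_verts (C : DirCycle n) (i : Fin C.length) : C.vert i ∈ C.verts := by
  simp [verts]

end DirCycle

/-- A common framework for the cycles of complete directed and undirected graphs: arcs determine
edges, cycles have length at least `minLen`, and each cycle of length `k` is represented by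
`mult * k` sequences of vertices. -/
structure CycleModel where
  Edge : ℕ → Type
  [fintypeEdge : ∀ n, Fintype (Edge n)]
  [decEqEdge : ∀ n, DecidableEq (Edge n)]
  ofArc : ∀ {n}, Arc n → Edge n
  ends : ∀ {n}, Edge n → Finset (Fin n)
  ends_ofArc : ∀ {n} (a : Arc n), ends (ofArc a) = {a.1.1, a.1.2}
  minLen : ℕ
  two_le_minLen : 2 ≤ minLen
  mult : ℕ
  mult_pos : 0 < mult
  edge_injective : ∀ {n} (C : DirCycle n), minLen ≤ C.length →
    Function.Injective fun i => ofArc (C.arc i)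
  card_fiber : ∀ {n} (C : DirCycle n), minLen ≤ C.length →
    (Finset.univ.filter fun v : Fin C.length ↪ Fin n =>
      (⟨C.length, C.two_le, v⟩ : DirCycle n).edgeSetOf ofArc = C.edgeSetOf ofArc).card =
      mult * C.length

attribute [instance] CycleModel.fintypeEdge CycleModel.decEqEdge

namespace CycleModel

variable (M : CycleModel) {n : ℕ}

/-- The set of edges of a cycle. -/
abbrev edgeSet (C : DirCycle n) : Finset (M.Edge n) := C.edgeSetOf M.ofArc

variable {M} in
theorem card_edgeSet {C : DirCycle n} (hC : M.minLen ≤ C.length) :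
    (M.edgeSet C).card = C.length := by
  rw [edgeSet, DirCycle.edgeSetOf, Finset.card_image_of_injective _ (M.edge_injective C hC),
    Finset.card_univ, Fintype.card_fin]

theorem ends_edge (C : DirCycle n) (i : Fin C.length) :
    M.ends (M.ofArc (C.arc i)) = {C.vert i, C.vert (finRotate C.length i)} :=
  M.ends_ofArc _

theorem biUnion_ends_edgeSet (C : DirCycle n) : (M.edgeSet C).biUnion M.ends = C.verts := by
  ext x
  simp only [edgeSet, DirCycle.edgeSetOf, Finset.mem_biUnion, Finset.mem_image, Finset.mem_univ,
    true_and, exists_exists_eq_and, ends_edge, DirCycle.verts, Finset.mem_map, Finset.mem_insert,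
    Finset.mem_singleton]
  constructor
  · rintro ⟨i, rfl | rfl⟩ <;> exact ⟨_, rfl⟩
  · rintro ⟨i, rfl⟩
    exact ⟨i, Or.inl rfl⟩

variable {M}

theorem ends_subset_verts {C : DirCycle n} {e : M.Edge n} (he : e ∈ M.edgeSet C) :
    M.ends e ⊆ C.verts := by
  rw [← M.biUnion_ends_edgeSet]
  exact Finset.subset_biUnion_of_mem _ he

/-- The shared edges form a nonempty proper part of `C`, hence a union of paths, and paths have more
vertices than edges. Those vertices lie on both cycles. -/
theorem card_inter_edgeSet_lt {C C' : DirCycle n} (hC : M.minLen ≤ C.length)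
    (hne : (M.edgeSet C ∩ M.edgeSet C').Nonempty) (hns : ¬ M.edgeSet C ⊆ M.edgeSet C') :
    (M.edgeSet C ∩ M.edgeSet C').card < (C.verts ∩ C'.verts).card := by
  set J := Finset.univ.filter fun i => M.ofArc (C.arc i) ∈ M.edgeSet C' with hJ
  have hinter : M.edgeSet C ∩ M.edgeSet C' = J.image fun i => M.ofArc (C.arc i) := by
    ext e
    simp only [edgeSet, DirCycle.edgeSetOf, Finset.mem_inter, Finset.mem_image, Finset.mem_univ,
      true_and, hJ, Finset.mem_filter]
    grind
  have hJne : J.Nonempty := by rwa [hinter, Finset.image_nonempty] at hne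
  have hJuniv : J ≠ Finset.univ := by
    intro h
    apply hns
    intro e he
    obtain ⟨i, -, rfl⟩ := Finset.mem_image.mp he
    have : i ∈ J := h ▸ Finset.mem_univ i
    exact (Finset.mem_filter.mp this).2
  rw [hinter, Finset.card_image_of_injective _ (M.edge_injective C hC)]
  refine (card_lt_card_union_image_finRotate C.two_le hJne hJuniv).trans_le ?_
  rw [← Finset.card_map C.vert]
  refine Finset.card_le_card fun x hx => ?_
  obtain ⟨i, hi, rfl⟩ := Finset.mem_map.mp hx
  refine Finset.mem_inter.mpr ⟨C.vert_mem_verts i, ?_⟩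
  rcases Finset.mem_union.mp hi with hi | hi
  · refine ends_subset_verts (Finset.mem_filter.mp hi).2 ?_
    rw [ends_edge]; simp
  · obtain ⟨j, hj, rfl⟩ := Finset.mem_image.mp hi
    refine ends_subset_verts (Finset.mem_filter.mp hj).2 ?_
    rw [ends_edge]; simp

/-- The union of two distinct cycles that share an edge has more edges than vertices. -/
theorem card_biUnion_ends_lt {C C' : DirCycle n} (hC : M.minLen ≤ C.length)
    (hC' : M.minLen ≤ C'.length) (hne : M.edgeSet C ≠ M.edgeSet C')
    (hd : ¬ Disjoint (M.edgeSet C) (M.edgeSet C')) :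
    ((M.edgeSet C ∪ M.edgeSet C').biUnion M.ends).card < (M.edgeSet C ∪ M.edgeSet C').card := by
  have hlt : (M.edgeSet C ∩ M.edgeSet C').card < (C.verts ∩ C'.verts).card := by
    rw [Finset.not_disjoint_iff_nonempty_inter] at hd
    by_cases hs : M.edgeSet C ⊆ M.edgeSet C'
    · have hs' : ¬ M.edgeSet C' ⊆ M.edgeSet C := fun h => hne (hs.antisymm h)
      rw [Finset.inter_comm, Finset.inter_comm C.verts]
      rw [Finset.inter_comm] at hd
      exact card_inter_edgeSet_lt hC' hd hs'
    · exact card_inter_edgeSet_lt hC hd hs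
  have h1 := Finset.card_union_add_card_inter (M.edgeSet C) (M.edgeSet C')
  have h2 := Finset.card_union_add_card_inter C.verts C'.verts
  rw [card_edgeSet hC, card_edgeSet hC'] at h1
  rw [DirCycle.card_verts, DirCycle.card_verts] at h2
  rw [Finset.union_biUnion, biUnion_ends_edgeSet, biUnion_ends_edgeSet]
  omega

variable (M)

open scoped Classical in
/-- The edge sets of the cycles of length `k`. -/
noncomputable def cycleSets (n k : ℕ) : Finset (Finset (M.Edge n)) :=
  Finset.univ.filter fun S => ∃ C : DirCycle n, C.length = k ∧ M.edgeSet C = S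

/-- The edge sets of the cycles of length at most `L`. -/
noncomputable def shortSets (n L : ℕ) : Finset (Finset (M.Edge n)) :=
  (Finset.Icc M.minLen L).biUnion (M.cycleSets n)

variable {M}

theorem mem_cycleSets {k : ℕ} {S : Finset (M.Edge n)} :
    S ∈ M.cycleSets n k ↔ ∃ C : DirCycle n, C.length = k ∧ M.edgeSet C = S := by
  simp [cycleSets]

theorem mem_shortSets {L : ℕ} {S : Finset (M.Edge n)} :
    S ∈ M.shortSets n L ↔
      ∃ C : DirCycle n, M.minLen ≤ C.length ∧ C.length ≤ L ∧ M.edgeSet C = S := by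
  simp only [shortSets, Finset.mem_biUnion, Finset.mem_Icc, mem_cycleSets]
  constructor
  · rintro ⟨k, ⟨h1, h2⟩, C, rfl, rfl⟩
    exact ⟨C, h1, h2, rfl⟩
  · rintro ⟨C, h1, h2, rfl⟩
    exact ⟨C.length, ⟨h1, h2⟩, C, rfl, rfl⟩

theorem card_of_mem_cycleSets {k : ℕ} (hk : M.minLen ≤ k) {S : Finset (M.Edge n)}
    (hS : S ∈ M.cycleSets n k) : S.card = k := by
  obtain ⟨C, rfl, rfl⟩ := mem_cycleSets.mp hS
  exact card_edgeSet hk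

theorem sum_shortSets (L : ℕ) (f : Finset (M.Edge n) → ℝ) :
    ∑ S ∈ M.shortSets n L, f S =
      ∑ k ∈ Finset.Icc M.minLen L, ∑ S ∈ M.cycleSets n k, f S := by
  rw [shortSets, Finset.sum_biUnion]
  intro k hk k' hk' hne
  refine Finset.disjoint_left.mpr fun S hS hS' => hne ?_
  rw [← card_of_mem_cycleSets (Finset.mem_Icc.mp hk).1 hS,
    card_of_mem_cycleSets (Finset.mem_Icc.mp hk').1 hS']

/-- Double counting: injective sequences of `k` vertices are grouped by edge set, and `card_fiber`
gives the size of each class. -/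
theorem mult_mul_card_cycleSets {k : ℕ} (hk : M.minLen ≤ k) :
    M.mult * k * (M.cycleSets n k).card = n.descFactorial k := by
  have h2 : 2 ≤ k := M.two_le_minLen.trans hk
  have hmaps : ∀ v ∈ (Finset.univ : Finset (Fin k ↪ Fin n)),
      M.edgeSet ⟨k, h2, v⟩ ∈ M.cycleSets n k := fun v _ => mem_cycleSets.mpr ⟨_, rfl, rfl⟩
  have hcard := Finset.card_eq_sum_card_fiberwise (s := Finset.univ) (t := M.cycleSets n k)
    (f := fun v : Fin k ↪ Fin n => M.edgeSet ⟨k, h2, v⟩) hmaps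
  rw [Finset.card_univ, Fintype.card_embedding_eq, Fintype.card_fin, Fintype.card_fin] at hcard
  rw [hcard, Finset.sum_const_nat (m := M.mult * k), mul_comm]
  intro S hS
  obtain ⟨C, rfl, rfl⟩ := mem_cycleSets.mp hS
  exact M.card_fiber C hk

variable (M) in
/-- The edges with both endpoints in `U`. -/
def edgesIn (U : Finset (Fin n)) : Finset (M.Edge n) :=
  (Finset.univ.filter fun a : Arc n => a.1.1 ∈ U ∧ a.1.2 ∈ U).image M.ofArc

theorem card_edgesIn_le (U : Finset (Fin n)) : (M.edgesIn U).card ≤ U.card ^ 2 := by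
  refine Finset.card_image_le.trans ?_
  rw [sq, ← Finset.card_product]
  refine Finset.card_le_card_of_injOn (fun a => a.1) ?_ Subtype.val_injective.injOn
  intro a ha
  simpa using ha

theorem edgeSet_subset_edgesIn {C : DirCycle n} {U : Finset (Fin n)} (h : C.verts ⊆ U) :
    M.edgeSet C ⊆ M.edgesIn U := by
  intro e he
  obtain ⟨i, -, rfl⟩ := Finset.mem_image.mp he
  refine Finset.mem_image_of_mem _ (Finset.mem_filter.mpr ⟨Finset.mem_univ _, ?_, ?_⟩)
  · exact h (C.vert_mem_verts _)
  · exact h (C.vert_mem_verts _)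

/-- The pairs of distinct short cycles that share an edge contribute little to second moments. -/
theorem sum_pairs_le (L : ℕ) {K : ℝ} (hK : 1 ≤ K) (hn : K ≤ n) :
    ∑ S ∈ M.shortSets n L, ∑ T ∈ M.shortSets n L with T ≠ S ∧ ¬ Disjoint S T,
      (K / n) ^ (S ∪ T).card ≤
      (2 * L + 1) * ((2 ^ (2 * L) ^ 2) ^ 2) * K ^ (2 * L + 1) / n := by
  have hn0 : (0 : ℝ) < n := by linarith
  have hx0 : 0 ≤ K / n := by positivity
  have hx1 : K / n ≤ 1 := (div_le_one hn0).mpr hn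
  -- This bounds the pairs of subsets of the at most `(2 * L) ^ 2` edges inside a set of at most `2
  -- * L` vertices.
  set B : ℕ := (2 ^ (2 * L) ^ 2) ^ 2 with hB
  rw [← Finset.sum_finset_product' ((M.shortSets n L ×ˢ M.shortSets n L).filter
    fun p => p.2 ≠ p.1 ∧ ¬ Disjoint p.1 p.2) _ _ (by intro p; simp; tauto)]
  set Q := (M.shortSets n L ×ˢ M.shortSets n L).filter
    fun p => p.2 ≠ p.1 ∧ ¬ Disjoint p.1 p.2 with hQ
  have hQ' : ∀ p ∈ Q, ∃ C C' : DirCycle n, M.minLen ≤ C.length ∧ C.length ≤ L ∧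
      M.minLen ≤ C'.length ∧ C'.length ≤ L ∧ M.edgeSet C = p.1 ∧ M.edgeSet C' = p.2 ∧
      M.edgeSet C ≠ M.edgeSet C' ∧ ¬ Disjoint (M.edgeSet C) (M.edgeSet C') := by
    intro p hp
    obtain ⟨hp1, hp2, hp3⟩ := Finset.mem_filter.mp hp
    obtain ⟨h1, h2⟩ := Finset.mem_product.mp hp1
    obtain ⟨C, hC1, hC2, hC3⟩ := mem_shortSets.mp h1
    obtain ⟨C', hC1', hC2', hC3'⟩ := mem_shortSets.mp h2
    exact ⟨C, C', hC1, hC2, hC1', hC2', hC3, hC3', by rw [hC3, hC3']; exact hp2.symm,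
      by rwa [hC3, hC3']⟩
  set u : Finset (M.Edge n) × Finset (M.Edge n) → Finset (Fin n) :=
    fun p => (p.1 ∪ p.2).biUnion M.ends with hu
  set W : Finset (Finset (Fin n)) := Finset.univ.filter fun U => U.card ≤ 2 * L with hW
  have hmaps : ∀ p ∈ Q, u p ∈ W := by
    intro p hp
    obtain ⟨C, C', hC1, hC2, hC1', hC2', h1, h2, -, -⟩ := hQ' p hp
    simp only [hW, hu, Finset.mem_filter, Finset.mem_univ, true_and, ← h1, ← h2]
    rw [Finset.union_biUnion, biUnion_ends_edgeSet, biUnion_ends_edgeSet]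
    refine (Finset.card_union_le _ _).trans ?_
    rw [DirCycle.card_verts, DirCycle.card_verts]; omega
  -- Pairs are grouped by the vertex set `U` of their union, which has at least `U.card + 1` edges.
  -- The at most `n ^ j` sets of size `j` each carry at most `B` pairs, so one factor `1 / n`
  -- survives.
  calc ∑ p ∈ Q, (K / n) ^ (p.1 ∪ p.2).card
      ≤ ∑ p ∈ Q, (K / n) ^ ((u p).card + 1) := by
        refine Finset.sum_le_sum fun p hp => pow_le_pow_of_le_one hx0 hx1 ?_
        obtain ⟨C, C', hC1, hC2, hC1', hC2', h1, h2, h3, h4⟩ := hQ' p hp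
        simp only [hu, ← h1, ← h2]
        exact card_biUnion_ends_lt hC1 hC1' h3 h4
    _ = ∑ U ∈ W, ∑ p ∈ Q with u p = U, (K / n) ^ ((u p).card + 1) :=
        (Finset.sum_fiberwise_of_maps_to hmaps _).symm
    _ ≤ ∑ U ∈ W, B * (K / n) ^ (U.card + 1) := by
        refine Finset.sum_le_sum fun U hU => ?_
        have hcard : (Q.filter fun p => u p = U).card ≤ B := by
          calc _ ≤ ((M.edgesIn U).powerset ×ˢ (M.edgesIn U).powerset).card := by
                refine Finset.card_le_card fun p hp => ?_
                obtain ⟨hpQ, rfl⟩ := Finset.mem_filter.mp hp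
                obtain ⟨C, C', -, -, -, -, h1, h2, -, -⟩ := hQ' p hpQ
                rw [Finset.mem_product, Finset.mem_powerset, Finset.mem_powerset]
                simp only [hu, ← h1, ← h2]
                rw [Finset.union_biUnion, biUnion_ends_edgeSet, biUnion_ends_edgeSet]
                exact ⟨edgeSet_subset_edgesIn Finset.subset_union_left,
                  edgeSet_subset_edgesIn Finset.subset_union_right⟩
            _ ≤ B := by
                rw [Finset.card_product, Finset.card_powerset, ← sq, hB]
                refine Nat.pow_le_pow_left (Nat.pow_le_pow_right two_pos ?_) 2
                exact (card_edgesIn_le U).trans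
                  (Nat.pow_le_pow_left (Finset.mem_filter.mp hU).2 2)
        calc _ = ((Q.filter fun p => u p = U).card : ℝ) * (K / n) ^ (U.card + 1) := by
              rw [← nsmul_eq_mul, ← Finset.sum_const]
              refine Finset.sum_congr rfl fun p hp => ?_
              rw [(Finset.mem_filter.mp hp).2]
          _ ≤ _ := by gcongr
    _ = ∑ j ∈ Finset.range (2 * L + 1), ∑ U ∈ W with U.card = j, B * (K / n) ^ (U.card + 1) :=
        (Finset.sum_fiberwise_of_maps_to (fun U hU => Finset.mem_range.mpr
          (Nat.lt_succ_of_le (Finset.mem_filter.mp hU).2)) _).symm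
    _ ≤ ∑ j ∈ Finset.range (2 * L + 1), B * K ^ (2 * L + 1) / n := by
        refine Finset.sum_le_sum fun j hj => ?_
        have hcard : ((W.filter fun U => U.card = j).card : ℝ) ≤ (n : ℝ) ^ j := by
          have : (W.filter fun U => U.card = j).card ≤ n ^ j := by
            calc _ ≤ (Finset.powersetCard j (Finset.univ : Finset (Fin n))).card := by
                  refine Finset.card_le_card fun U hU => ?_
                  simpa using (Finset.mem_filter.mp hU).2
              _ ≤ n ^ j := by
                  rw [Finset.card_powersetCard, Finset.card_univ, Fintype.card_fin]
                  exact Nat.choose_le_pow n j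
          exact_mod_cast this
        calc _ = ((W.filter fun U => U.card = j).card : ℝ) * (B * (K / n) ^ (j + 1)) := by
              rw [← nsmul_eq_mul, ← Finset.sum_const]
              refine Finset.sum_congr rfl fun U hU => ?_
              rw [(Finset.mem_filter.mp hU).2]
          _ ≤ (n : ℝ) ^ j * (B * (K / n) ^ (j + 1)) := by gcongr
          _ = B * K ^ (j + 1) / n := by
              rw [div_pow, pow_succ (n : ℝ) j]; field_simp
          _ ≤ _ := by
              gcongr
              exact Nat.lt_succ_iff.mp (Finset.mem_range.mp hj)
    _ = _ := by
        rw [Finset.sum_const, Finset.card_range, nsmul_eq_mul, hB]; push_cast; ring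

end CycleModel

/-! ### Vertex sequences representing the same cycle -/

section Shift

variable {n N : ℕ}

/-- The sequence of vertices `v`, started at position `j`. -/
def shiftEmb (v : Fin (N + 1) ↪ Fin n) (j : Fin (N + 1)) : Fin (N + 1) ↪ Fin n :=
  (Equiv.addRight j).toEmbedding.trans v

/-- The reversed sequence of vertices. -/
def revEmb (v : Fin (N + 1) ↪ Fin n) : Fin (N + 1) ↪ Fin n :=
  (Equiv.neg _).toEmbedding.trans v

@[simp]
theorem shiftEmb_apply (v : Fin (N + 1) ↪ Fin n) (j i : Fin (N + 1)) :
    shiftEmb v j i = v (i + j) := rfl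

@[simp]
theorem revEmb_apply (v : Fin (N + 1) ↪ Fin n) (i : Fin (N + 1)) : revEmb v i = v (-i) := rfl

theorem shiftEmb_injective (v : Fin (N + 1) ↪ Fin n) : Function.Injective (shiftEmb v) := by
  intro j j' h
  have := DFunLike.congr_fun h 0
  simpa using this

theorem Fin.one_add_one_ne_zero_of_three_le (hN : 3 ≤ N + 1) : (1 : Fin (N + 1)) + 1 ≠ 0 := by
  intro h
  have := congrArg Fin.val h
  rw [Fin.val_add, Fin.val_one', Nat.mod_eq_of_lt (by omega : 1 < N + 1),
    Nat.mod_eq_of_lt (by omega)] at this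
  simp at this

section Directed

variable (h : 2 ≤ N + 1)

theorem mem_edgeSetOf_id {v : Fin (N + 1) ↪ Fin n} {a : Arc n} :
    a ∈ (⟨N + 1, h, v⟩ : DirCycle n).edgeSetOf id ↔ ∃ i, a.1 = (v i, v (i + 1)) := by
  simp only [DirCycle.edgeSetOf, DirCycle.arc, finRotate_apply, Finset.mem_image,
    Finset.mem_univ, true_and, id_eq, Subtype.ext_iff]
  simp [eq_comm]

/-- The position of `v' 0` in `v` fixes the shift. Each vertex has only one outgoing arc in the
cycle, so the remaining vertices are forced. -/
theorem edgeSetOf_id_eq_iff {v v' : Fin (N + 1) ↪ Fin n} :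
    (⟨N + 1, h, v'⟩ : DirCycle n).edgeSetOf id = (⟨N + 1, h, v⟩ : DirCycle n).edgeSetOf id ↔
      ∃ j, shiftEmb v j = v' := by
  constructor
  · intro heq
    have hedge : ∀ i, ∃ m, v' i = v m ∧ v' (i + 1) = v (m + 1) := by
      intro i
      have hmem : (⟨N + 1, h, v'⟩ : DirCycle n).arc i ∈
          (⟨N + 1, h, v⟩ : DirCycle n).edgeSetOf id := by
        rw [← heq]; exact Finset.mem_image_of_mem _ (Finset.mem_univ i)
      obtain ⟨m, hm⟩ := (mem_edgeSetOf_id h).mp hmem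
      simp only [DirCycle.arc, finRotate_apply, Prod.mk.injEq] at hm
      exact ⟨m, hm⟩
    obtain ⟨j, hj, -⟩ := hedge 0
    refine ⟨j, ?_⟩
    ext1 i
    rw [shiftEmb_apply]
    induction i using Fin.induction with
    | zero => rw [zero_add, hj]
    | succ i ih =>
      obtain ⟨m, hm1, hm2⟩ := hedge i.castSucc
      have : i.castSucc + j = m := v.injective (ih.trans hm1)
      rw [← Fin.coeSucc_eq_succ, hm2, ← this, add_right_comm]
  · rintro ⟨j, rfl⟩
    ext a
    rw [mem_edgeSetOf_id, mem_edgeSetOf_id]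
    constructor
    · rintro ⟨i, hi⟩
      exact ⟨i + j, by rw [hi, shiftEmb_apply, shiftEmb_apply, add_right_comm]⟩
    · rintro ⟨i, hi⟩
      refine ⟨i - j, ?_⟩
      rw [hi, shiftEmb_apply, shiftEmb_apply, add_right_comm, sub_add_cancel]

end Directed

/-- The directed model. -/
def dirModel : CycleModel where
  Edge := Arc
  ofArc := id
  ends := fun a => {a.1.1, a.1.2}
  ends_ofArc := fun _ => rfl
  minLen := 2
  two_le_minLen := le_rfl
  mult := 1
  mult_pos := one_pos
  edge_injective := fun C _ i j hij => by
    have := congrArg (fun a : Arc _ => a.1.1) hij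
    exact C.vert.injective this
  card_fiber := by
    rintro n ⟨k, h, v⟩ -
    obtain ⟨N, rfl⟩ : ∃ N, k = N + 1 := ⟨k - 1, by omega⟩
    have : (Finset.univ.filter fun v' : Fin (N + 1) ↪ Fin n =>
        (⟨N + 1, h, v'⟩ : DirCycle n).edgeSetOf id = (⟨N + 1, h, v⟩ : DirCycle n).edgeSetOf id) =
        Finset.univ.image (shiftEmb v) := by
      ext v'
      simp [edgeSetOf_id_eq_iff h]
    simp only
    rw [this, Finset.card_image_of_injective _ (shiftEmb_injective v), Finset.card_univ,
      Fintype.card_fin, one_mul]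

section Undirected

/-- The undirected edge underlying an arc. -/
def Arc.toUEdge (a : Arc n) : UEdge n := ⟨s(a.1.1, a.1.2), fun h => a.2 (Sym2.mk_isDiag_iff.mp h)⟩

variable (h : 2 ≤ N + 1)

theorem mem_edgeSetOf_toUEdge {v : Fin (N + 1) ↪ Fin n} {e : UEdge n} :
    e ∈ (⟨N + 1, h, v⟩ : DirCycle n).edgeSetOf Arc.toUEdge ↔ ∃ i, e.1 = s(v i, v (i + 1)) := by
  simp only [DirCycle.edgeSetOf, DirCycle.arc, finRotate_apply, Finset.mem_image,
    Finset.mem_univ, true_and, Arc.toUEdge, Subtype.ext_iff]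
  simp only [eq_comm]

theorem edgeSetOf_toUEdge_shiftEmb (v : Fin (N + 1) ↪ Fin n) (j : Fin (N + 1)) :
    (⟨N + 1, h, shiftEmb v j⟩ : DirCycle n).edgeSetOf Arc.toUEdge =
      (⟨N + 1, h, v⟩ : DirCycle n).edgeSetOf Arc.toUEdge := by
  ext a
  rw [mem_edgeSetOf_toUEdge, mem_edgeSetOf_toUEdge]
  constructor
  · rintro ⟨i, hi⟩
    exact ⟨i + j, by rw [hi, shiftEmb_apply, shiftEmb_apply, add_right_comm]⟩
  · rintro ⟨i, hi⟩
    refine ⟨i - j, ?_⟩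
    rw [hi, shiftEmb_apply, shiftEmb_apply, add_right_comm, sub_add_cancel]

theorem edgeSetOf_toUEdge_revEmb (v : Fin (N + 1) ↪ Fin n) :
    (⟨N + 1, h, revEmb v⟩ : DirCycle n).edgeSetOf Arc.toUEdge =
      (⟨N + 1, h, v⟩ : DirCycle n).edgeSetOf Arc.toUEdge := by
  ext a
  rw [mem_edgeSetOf_toUEdge, mem_edgeSetOf_toUEdge]
  constructor
  · rintro ⟨i, hi⟩
    -- Edge `i` of the reversed sequence joins positions `-i` and `-(i + 1)` of `v`, so it is edge
    -- `-(i + 1)` of `v` read backwards.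
    refine ⟨-(i + 1), ?_⟩
    rw [hi, revEmb_apply, revEmb_apply, Sym2.eq_swap, neg_add, neg_add_cancel_right]
  · rintro ⟨i, hi⟩
    refine ⟨-(i + 1), ?_⟩
    rw [hi, revEmb_apply, revEmb_apply, Sym2.eq_swap, neg_neg, neg_add, neg_neg,
      add_neg_cancel_right]

/-- The first two vertices fix the starting point and the direction. Afterwards the sequence cannot
turn back: reversing the next edge would revisit the previous vertex, giving `1 + 1 = 0`, which
fails for length at least `3`. -/
theorem exists_shiftEmb_of_edges (h3 : 3 ≤ N + 1) {v v' : Fin (N + 1) ↪ Fin n}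
    (hedge : ∀ i, ∃ m, s(v' i, v' (i + 1)) = s(v m, v (m + 1))) {j : Fin (N + 1)}
    (h0 : v' 0 = v j) (h1 : v' 1 = v (j + 1)) : shiftEmb v j = v' := by
  have key : ∀ i, v' i = v (i + j) ∧ v' (i + 1) = v (i + 1 + j) := by
    intro i
    induction i using Fin.induction with
    | zero => simp [h0, h1, add_comm]
    | succ i ih =>
      rw [← Fin.coeSucc_eq_succ]
      set i' := i.castSucc
      refine ⟨ih.2, ?_⟩
      obtain ⟨m, hm⟩ := hedge (i' + 1)
      rcases Sym2.eq_iff.mp hm with ⟨hm1, hm2⟩ | ⟨hm1, hm2⟩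
      · have : i' + 1 + j = m := v.injective (ih.2.symm.trans hm1)
        rw [hm2, ← this, add_right_comm _ j]
      · exfalso
        have h1 : i' + 1 + j = m + 1 := v.injective (ih.2.symm.trans hm1)
        have h2 : i' + j = m := by
          rw [add_right_comm] at h1
          exact add_right_cancel h1
        rw [← h2, ← ih.1] at hm2
        have h3' := v'.injective hm2
        rw [add_assoc] at h3'
        exact Fin.one_add_one_ne_zero_of_three_le h3 (left_eq_add.mp h3'.symm)
  ext1 i
  exact (key i).1.symm

/-- The first edge of `v'` is traversed in the direction of `v` or against it; these cases give the
two families, hence the multiplicity `2`. -/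
theorem edgeSetOf_toUEdge_eq_iff (h3 : 3 ≤ N + 1) {v v' : Fin (N + 1) ↪ Fin n} :
    (⟨N + 1, h, v'⟩ : DirCycle n).edgeSetOf Arc.toUEdge =
      (⟨N + 1, h, v⟩ : DirCycle n).edgeSetOf Arc.toUEdge ↔
      (∃ j, shiftEmb v j = v') ∨ ∃ j, shiftEmb (revEmb v) j = v' := by
  constructor
  · intro heq
    have hedge : ∀ i, ∃ m, s(v' i, v' (i + 1)) = s(v m, v (m + 1)) := by
      intro i
      have hmem : ((⟨N + 1, h, v'⟩ : DirCycle n).arc i).toUEdge ∈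
          (⟨N + 1, h, v⟩ : DirCycle n).edgeSetOf Arc.toUEdge := by
        rw [← heq]
        exact Finset.mem_image_of_mem (fun i => ((⟨N + 1, h, v'⟩ : DirCycle n).arc i).toUEdge)
          (Finset.mem_univ i)
      obtain ⟨m, hm⟩ := (mem_edgeSetOf_toUEdge h).mp hmem
      simp only [Arc.toUEdge, DirCycle.arc, finRotate_apply] at hm
      exact ⟨m, hm⟩
    obtain ⟨m, hm⟩ := hedge 0
    rw [zero_add] at hm
    rcases Sym2.eq_iff.mp hm with ⟨hm1, hm2⟩ | ⟨hm1, hm2⟩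
    · exact Or.inl ⟨m, exists_shiftEmb_of_edges h3 hedge hm1 hm2⟩
    · refine Or.inr ⟨-(m + 1), exists_shiftEmb_of_edges h3 ?_ ?_ ?_⟩
      · intro i
        obtain ⟨m, hm⟩ := hedge i
        refine ⟨-(m + 1), ?_⟩
        rw [hm, revEmb_apply, revEmb_apply, Sym2.eq_swap, neg_neg, neg_add, neg_neg,
          add_neg_cancel_right]
      · rw [hm1, revEmb_apply, neg_neg]
      · rw [hm2, revEmb_apply, neg_add, neg_neg, add_neg_cancel_right]
  · rintro (⟨j, rfl⟩ | ⟨j, rfl⟩)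
    · exact edgeSetOf_toUEdge_shiftEmb h v j
    · rw [edgeSetOf_toUEdge_shiftEmb, edgeSetOf_toUEdge_revEmb]

theorem shiftEmb_ne_shiftEmb_revEmb (h3 : 3 ≤ N + 1) (v : Fin (N + 1) ↪ Fin n)
    (j j' : Fin (N + 1)) : shiftEmb v j ≠ shiftEmb (revEmb v) j' := by
  intro heq
  have h0 := v.injective (DFunLike.congr_fun heq 0)
  have h1 := v.injective (DFunLike.congr_fun heq 1)
  simp only [Equiv.coe_toEmbedding, Equiv.coe_addRight, Equiv.neg_apply, zero_add] at h0 h1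
  rw [h0, neg_add, add_left_inj] at h1
  exact Fin.one_add_one_ne_zero_of_three_le h3 (eq_neg_iff_add_eq_zero.mp h1)

theorem toUEdge_arc_injective (C : DirCycle n) (hC : 3 ≤ C.length) :
    Function.Injective fun i => (C.arc i).toUEdge := by
  obtain ⟨k, h, v⟩ := C
  obtain ⟨N, rfl⟩ : ∃ N, k = N + 1 := ⟨k - 1, by omega⟩
  intro i j hij
  simp only [Arc.toUEdge, DirCycle.arc, finRotate_apply, Subtype.mk.injEq] at hij
  rcases Sym2.eq_iff.mp hij with ⟨h1, -⟩ | ⟨h1, h2⟩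
  · exact v.injective h1
  · exfalso
    have h1 := v.injective h1
    have h2 := v.injective h2
    rw [h1, add_assoc] at h2
    exact Fin.one_add_one_ne_zero_of_three_le hC (left_eq_add.mp h2.symm)

end Undirected

/-- The undirected model. -/
def undirModel : CycleModel where
  Edge := UEdge
  ofArc := Arc.toUEdge
  ends := fun e => Finset.univ.filter fun x => x ∈ e.1
  ends_ofArc := fun a => by
    ext x
    simp [Arc.toUEdge]
  minLen := 3
  two_le_minLen := by norm_num
  mult := 2
  mult_pos := two_pos
  edge_injective := toUEdge_arc_injective
  card_fiber := by
    rintro n ⟨k, h, v⟩ h3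
    obtain ⟨N, rfl⟩ : ∃ N, k = N + 1 := ⟨k - 1, by omega⟩
    have : (Finset.univ.filter fun v' : Fin (N + 1) ↪ Fin n =>
        (⟨N + 1, h, v'⟩ : DirCycle n).edgeSetOf Arc.toUEdge =
          (⟨N + 1, h, v⟩ : DirCycle n).edgeSetOf Arc.toUEdge) =
        Finset.univ.image (shiftEmb v) ∪ Finset.univ.image (shiftEmb (revEmb v)) := by
      ext v'
      simp [edgeSetOf_toUEdge_eq_iff h h3]
    simp only
    rw [this, Finset.card_union_of_disjoint, Finset.card_image_of_injective _ (shiftEmb_injective _),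
      Finset.card_image_of_injective _ (shiftEmb_injective _), Finset.card_univ,
      Fintype.card_fin, two_mul]
    rw [Finset.disjoint_left]
    intro v' h1 h2
    obtain ⟨j, -, rfl⟩ := Finset.mem_image.mp h1
    obtain ⟨j', -, hj'⟩ := Finset.mem_image.mp h2
    exact shiftEmb_ne_shiftEmb_revEmb h3 v j j' hj'.symm

end Shift

/-! ### Limiting rates and their behaviour around `1 / e` -/

section Rate

/-- The limiting expected number of cycles of length `k` and mean weight at most `c / n`, when each
cycle is represented by `m * k` sequences of vertices. -/
noncomputable def rate (m k : ℕ) (c : ℝ) : ℝ := (k * c) ^ k / (m * k * k.factorial)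

/-- The derivative of `rate`. -/
noncomputable def rateDeriv (m k : ℕ) (c : ℝ) : ℝ := c ^ (k - 1) * (k : ℝ) ^ k / (m * k.factorial)

variable {m k : ℕ}

theorem rate_nonneg {c : ℝ} (hc : 0 ≤ c) : 0 ≤ rate m k c := by unfold rate; positivity

theorem rateDeriv_nonneg {c : ℝ} (hc : 0 ≤ c) : 0 ≤ rateDeriv m k c := by
  unfold rateDeriv; positivity

theorem rate_mono {c d : ℝ} (hc : 0 ≤ c) (hcd : c ≤ d) : rate m k c ≤ rate m k d := by
  unfold rate; gcongr

theorem rate_zero (hk : k ≠ 0) : rate m k 0 = 0 := by simp [rate, hk]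

theorem continuous_rate : Continuous (rate m k) := by unfold rate; fun_prop

theorem continuous_rateDeriv : Continuous (rateDeriv m k) := by unfold rateDeriv; fun_prop

theorem hasDerivAt_rate (hk : k ≠ 0) (c : ℝ) : HasDerivAt (rate m k) (rateDeriv m k c) c := by
  have h := ((hasDerivAt_id c).const_mul (k : ℝ)).pow k |>.div_const (m * k * k.factorial : ℝ)
  refine (h.congr_deriv ?_).congr_of_eventuallyEq (Eventually.of_forall fun x => by simp [rate])
  obtain ⟨j, rfl⟩ := Nat.exists_eq_succ_of_ne_zero hk
  have h1 : ((j.succ : ℕ) : ℝ) ≠ 0 := by positivity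
  have h2 : ((j.succ).factorial : ℝ) ≠ 0 := by positivity
  rcases Nat.eq_zero_or_pos m with rfl | hm
  · simp [rateDeriv]
  have h3 : (m : ℝ) ≠ 0 := by positivity
  simp only [rateDeriv, id_eq, Nat.succ_eq_add_one, Nat.add_sub_cancel, mul_one] at *
  field_simp
  ring

/-- Stirling's lower bound for the factorial cancels the exponential growth exactly at `1 / e`. The
exponent `3 / 2` left over makes the rates summable there. -/
theorem rate_le_inv_rpow (hm : 0 < m) (hk : k ≠ 0) :
    rate m k (1 / Real.exp 1) ≤ 1 / (k : ℝ) ^ (3 / 2 : ℝ) := by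
  have hk0 : (0 : ℝ) < k := by positivity
  have hst := Stirling.le_factorial_stirling k
  have hle : Real.sqrt k * (k / Real.exp 1) ^ k ≤ k.factorial := by
    refine le_trans ?_ hst
    gcongr
    nlinarith [Real.pi_gt_three]
  have hs0 : 0 < Real.sqrt k := Real.sqrt_pos.mpr hk0
  have hpow : (k : ℝ) ^ (3 / 2 : ℝ) = k * Real.sqrt k := by
    rw [Real.sqrt_eq_rpow, show (3 / 2 : ℝ) = 1 + 1 / 2 by norm_num, Real.rpow_add hk0,
      Real.rpow_one]
  rw [rate, hpow, mul_one_div, div_le_div_iff₀ (by positivity) (by positivity), one_mul]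
  have hm1 : (1 : ℝ) ≤ m := by exact_mod_cast hm
  calc (k / Real.exp 1) ^ k * (k * Real.sqrt k)
      = 1 * k * (Real.sqrt k * (k / Real.exp 1) ^ k) := by ring
    _ ≤ m * k * k.factorial := by gcongr

theorem summable_rate_inv_exp (hm : 0 < m) : Summable fun k => rate m k (1 / Real.exp 1) := by
  refine Summable.of_norm_bounded_eventually_nat
    (Real.summable_one_div_nat_rpow.mpr (by norm_num : (1 : ℝ) < 3 / 2)) ?_
  filter_upwards [eventually_ne_atTop 0] with k hk
  rw [Real.norm_of_nonneg (rate_nonneg (by positivity))]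
  exact rate_le_inv_rpow hm hk

theorem summable_rate (hm : 0 < m) {c : ℝ} (h0 : 0 ≤ c) (hc : c ≤ 1 / Real.exp 1) :
    Summable fun k => rate m k c :=
  (summable_rate_inv_exp hm).of_nonneg_of_le (fun _ => rate_nonneg h0) fun _ => rate_mono h0 hc

/-- Stirling's sequence decreases from its value `e / √2` at `1`. The bound is weakened from `√k` to
`k`, as only the exponential order is needed. -/
theorem factorial_le_exp_mul (hk : k ≠ 0) :
    (k.factorial : ℝ) ≤ Real.exp 1 * k * (k / Real.exp 1) ^ k := by
  obtain ⟨j, rfl⟩ := Nat.exists_eq_succ_of_ne_zero hk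
  have h := Stirling.stirlingSeq'_antitone (Nat.zero_le j)
  simp only [Function.comp_apply, Nat.succ_eq_add_one, zero_add, Stirling.stirlingSeq_one] at h
  set k : ℕ := j + 1 with hkdef
  have hk0 : (0 : ℝ) < k := by positivity
  have hk1 : (1 : ℝ) ≤ k := by rw [hkdef]; push_cast; linarith [Nat.cast_nonneg (α := ℝ) j]
  rw [Stirling.stirlingSeq, div_le_iff₀ (by positivity)] at h
  refine h.trans ?_
  rw [← mul_assoc]
  refine mul_le_mul_of_nonneg_right ?_ (by positivity)
  rw [Real.sqrt_mul zero_le_two]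
  have h2 : Real.sqrt 2 ≠ 0 := by positivity
  have : Real.sqrt k ≤ k := by
    rw [Real.sqrt_le_left hk0.le]; nlinarith
  calc Real.exp 1 / Real.sqrt 2 * (Real.sqrt 2 * Real.sqrt k) = Real.exp 1 * Real.sqrt k := by
        field_simp
    _ ≤ _ := by gcongr

/-- Up to a polynomial factor the rate is at least `(e * b) ^ k`, and `e * b > 1`. -/
theorem tendsto_rate_atTop (hm : 0 < m) {b : ℝ} (hb : 1 / Real.exp 1 < b) :
    Tendsto (fun k => rate m k b) atTop atTop := by
  have he := Real.exp_pos 1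
  have hb0 : 0 < b := lt_trans (by positivity) hb
  set r := Real.exp 1 * b with hr
  have hr1 : 1 < r := by rwa [div_lt_iff₀' he] at hb
  have hm0 : (0 : ℝ) < m := by exact_mod_cast hm
  have hlim : Tendsto (fun k : ℕ => r ^ k / (k : ℝ) ^ 2) atTop atTop := by
    have h := tendsto_pow_const_div_const_pow_of_one_lt 2 hr1
    have h' : Tendsto (fun k : ℕ => (k : ℝ) ^ 2 / r ^ k) atTop (𝓝[>] 0) := by
      refine tendsto_nhdsWithin_iff.mpr ⟨h, ?_⟩
      filter_upwards [eventually_gt_atTop 0] with k hk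
      have : (0 : ℝ) < k := by exact_mod_cast hk
      exact Set.mem_Ioi.mpr (by positivity)
    refine h'.inv_tendsto_nhdsGT_zero.congr fun k => ?_
    simp
  refine tendsto_atTop_mono' _ ?_ (hlim.const_mul_atTop (show 0 < 1 / (m * Real.exp 1) by positivity))
  filter_upwards [eventually_ne_atTop 0] with k hk
  have hk0 : (0 : ℝ) < k := by positivity
  rw [rate, le_div_iff₀ (by positivity)]
  calc 1 / (m * Real.exp 1) * (r ^ k / (k : ℝ) ^ 2) * (m * k * k.factorial)
      ≤ 1 / (m * Real.exp 1) * (r ^ k / (k : ℝ) ^ 2) *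
        (m * k * (Real.exp 1 * k * (k / Real.exp 1) ^ k)) := by
        gcongr; exact factorial_le_exp_mul hk
    _ = (k * b) ^ k := by
        rw [hr, mul_pow, div_pow, mul_pow]; field_simp

/-- The limiting expected number of cycles of length between `l` and `L`. -/
noncomputable def rateSum (m l L : ℕ) (c : ℝ) : ℝ := ∑ k ∈ Finset.Icc l L, rate m k c

/-- The limiting expected number of cycles of length at least `l`. -/
noncomputable def rateTotal (m l : ℕ) (c : ℝ) : ℝ := ∑' j, rate m (j + l) c

theorem rateSum_eq_sum_range (m l J : ℕ) (c : ℝ) :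
    rateSum m l (l + J) c = ∑ j ∈ Finset.range (J + 1), rate m (j + l) c := by
  rw [rateSum, Finset.range_eq_Ico, Finset.sum_Ico_add' (fun k => rate m k c)]
  congr 1
  ext x; simp only [Finset.mem_Icc, Finset.mem_Ico]; omega

theorem summable_rate_add (hm : 0 < m) (l : ℕ) {c : ℝ} (h0 : 0 ≤ c) (hc : c ≤ 1 / Real.exp 1) :
    Summable fun j => rate m (j + l) c :=
  (summable_nat_add_iff l).mpr (summable_rate hm h0 hc)

theorem rateSum_le_rateTotal (hm : 0 < m) (l L : ℕ) {c : ℝ} (h0 : 0 ≤ c)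
    (hc : c ≤ 1 / Real.exp 1) : rateSum m l L c ≤ rateTotal m l c := by
  refine le_trans ?_ ((summable_rate_add hm l h0 hc).sum_le_tsum (Finset.range (L + 1))
    fun _ _ => rate_nonneg h0)
  rw [← rateSum_eq_sum_range]
  exact Finset.sum_le_sum_of_subset_of_nonneg
    (Finset.Icc_subset_Icc le_rfl (Nat.le_add_left L l)) fun _ _ _ => rate_nonneg h0

/-- The part of `rateTotal` not captured by `rateSum` is largest at `1 / e`. -/
theorem rateTotal_sub_rateSum_le (hm : 0 < m) {l L : ℕ} (hL : l ≤ L) {c : ℝ} (h0 : 0 ≤ c)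
    (hc : c ≤ 1 / Real.exp 1) :
    rateTotal m l c - rateSum m l L c ≤ ∑' j, rate m (j + (L + 1)) (1 / Real.exp 1) := by
  obtain ⟨J, rfl⟩ := Nat.exists_eq_add_of_le hL
  rw [rateSum_eq_sum_range, rateTotal,
    ← (summable_rate_add hm l h0 hc).sum_add_tsum_nat_add (J + 1), add_sub_cancel_left]
  have e : ∀ j, j + (J + 1) + l = j + (l + J + 1) := fun j => by ring
  simp only [e]
  exact Summable.tsum_le_tsum (fun j => rate_mono h0 hc) (summable_rate_add hm _ h0 hc)
    (summable_rate_add hm _ (by positivity) le_rfl)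

theorem tendsto_tsum_rate_tail (m : ℕ) :
    Tendsto (fun L => ∑' j, rate m (j + (L + 1)) (1 / Real.exp 1)) atTop (𝓝 0) :=
  (tendsto_sum_nat_add fun k => rate m k (1 / Real.exp 1)).comp (tendsto_add_atTop_nat 1)

theorem tendsto_rateSum_atTop (hm : 0 < m) (l : ℕ) {b : ℝ} (hb : 1 / Real.exp 1 < b) :
    Tendsto (fun L => rateSum m l L b) atTop atTop := by
  have hb0 : 0 ≤ b := le_trans (by positivity) hb.le
  refine tendsto_atTop_mono' _ ?_ (tendsto_rate_atTop hm hb)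
  filter_upwards [eventually_ge_atTop l] with L hL
  exact Finset.single_le_sum (f := fun k => rate m k b) (fun _ _ => rate_nonneg hb0)
    (Finset.mem_Icc.mpr ⟨hL, le_rfl⟩)

theorem continuousOn_rateTotal (hm : 0 < m) (l : ℕ) :
    ContinuousOn (rateTotal m l) (Set.Icc 0 (1 / Real.exp 1)) := by
  refine continuousOn_tsum (fun j => continuous_rate.continuousOn)
    (summable_rate_add hm l (by positivity) le_rfl) fun j c hc => ?_
  rw [Real.norm_of_nonneg (rate_nonneg hc.1)]
  exact rate_mono hc.1 hc.2

theorem continuous_rateSum (l L : ℕ) : Continuous (rateSum m l L) := by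
  unfold rateSum
  exact continuous_finsetSum _ fun k _ => continuous_rate

theorem rateSum_nonneg (l L : ℕ) {c : ℝ} (hc : 0 ≤ c) : 0 ≤ rateSum m l L c :=
  Finset.sum_nonneg fun _ _ => rate_nonneg hc

/-- The limiting probability of length `k`. -/
noncomputable def limitProb (m l k : ℕ) : ℝ :=
  ∫ c in (0 : ℝ)..(1 / Real.exp 1), rateDeriv m k c * Real.exp (-rateTotal m l c)

theorem intervalIntegrable_limitProb (hm : 0 < m) (l k : ℕ) :
    IntervalIntegrable (fun c => rateDeriv m k c * Real.exp (-rateTotal m l c)) volume 0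
      (1 / Real.exp 1) := by
  refine ContinuousOn.intervalIntegrable ?_
  rw [Set.uIcc_of_le (by positivity)]
  exact continuous_rateDeriv.continuousOn.mul (continuousOn_rateTotal hm l).neg.rexp

theorem limitProb_nonneg (m l k : ℕ) : 0 ≤ limitProb m l k :=
  intervalIntegral.integral_nonneg (by positivity) fun c hc =>
    mul_nonneg (rateDeriv_nonneg hc.1) (Real.exp_pos _).le

theorem limitProb_le_integral (hm : 0 < m) (l L k : ℕ) :
    limitProb m l k ≤
      ∫ c in (0 : ℝ)..(1 / Real.exp 1), rateDeriv m k c * Real.exp (-rateSum m l L c) := by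
  refine intervalIntegral.integral_mono_on (by positivity) (intervalIntegrable_limitProb hm l k)
    ((continuous_rateDeriv.mul (continuous_rateSum l L).neg.rexp).intervalIntegrable _ _)
    fun c hc => ?_
  have := rateSum_le_rateTotal hm l L hc.1 hc.2
  have := rateDeriv_nonneg (m := m) (k := k) hc.1
  gcongr

/-- Truncating the exponent at `L` changes the exponential by at most the tail of the rates, by `1 -
x ≤ exp (-x)`. Integrating this against `rateDeriv` produces the factor `rate`. -/
theorem integral_sub_limitProb_le (hm : 0 < m) {l L : ℕ} (hL : l ≤ L) (hk : k ≠ 0) :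
    (∫ c in (0 : ℝ)..(1 / Real.exp 1), rateDeriv m k c * Real.exp (-rateSum m l L c)) ≤
      limitProb m l k + rate m k (1 / Real.exp 1) *
        ∑' j, rate m (j + (L + 1)) (1 / Real.exp 1) := by
  set τ := ∑' j, rate m (j + (L + 1)) (1 / Real.exp 1) with hτ
  have hrate : rate m k (1 / Real.exp 1) = ∫ c in (0 : ℝ)..(1 / Real.exp 1), rateDeriv m k c := by
    rw [intervalIntegral.integral_eq_sub_of_hasDerivAt (fun c _ => hasDerivAt_rate hk c)
      (continuous_rateDeriv.intervalIntegrable _ _), rate_zero hk, sub_zero]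
  have hc2 : IntervalIntegrable (fun c => rateDeriv m k c * τ) volume 0 (1 / Real.exp 1) :=
    (continuous_rateDeriv.mul continuous_const).intervalIntegrable _ _
  rw [hrate, limitProb, ← intervalIntegral.integral_mul_const,
    ← intervalIntegral.integral_add (intervalIntegrable_limitProb hm l k) hc2]
  refine intervalIntegral.integral_mono_on (by positivity)
    ((continuous_rateDeriv.mul (continuous_rateSum l L).neg.rexp).intervalIntegrable _ _)
    ((intervalIntegrable_limitProb hm l k).add hc2) fun c hc => ?_
  have hd := rateDeriv_nonneg (m := m) (k := k) hc.1
  rw [← mul_add]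
  refine mul_le_mul_of_nonneg_left ?_ hd
  have h1 := rateTotal_sub_rateSum_le hm hL hc.1 hc.2
  have h2 := rateSum_nonneg (m := m) l L hc.1
  set x := rateSum m l L c
  set y := rateTotal m l c
  have h3 : 1 - (y - x) ≤ Real.exp (-(y - x)) := by linarith [Real.add_one_le_exp (-(y - x))]
  have h4 : Real.exp (-y) = Real.exp (-x) * Real.exp (-(y - x)) := by
    rw [← Real.exp_add]; ring_nf
  have h5 : Real.exp (-x) ≤ 1 := Real.exp_le_one_iff.mpr (by linarith)
  have h6 : 0 < Real.exp (-x) := Real.exp_pos _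
  have h7 : x ≤ y := rateSum_le_rateTotal hm l L hc.1 hc.2
  nlinarith

theorem hasDerivAt_rateSum {l : ℕ} (hl : 0 < l) (L : ℕ) (c : ℝ) :
    HasDerivAt (rateSum m l L) (∑ k ∈ Finset.Icc l L, rateDeriv m k c) c := by
  have := HasDerivAt.fun_sum (u := Finset.Icc l L) (A := fun k => rate m k)
    (A' := fun k => rateDeriv m k c) (x := c) fun k hk =>
      hasDerivAt_rate (by have := (Finset.mem_Icc.mp hk).1; omega) c
  exact this

/-- With the exponent truncated to the same lengths as the sum, the integrand is exactly the
derivative of `-exp (-rateSum)`. -/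
theorem sum_limitProb_le (hm : 0 < m) {l : ℕ} (hl : 0 < l) (L : ℕ) :
    ∑ k ∈ Finset.Icc l L, limitProb m l k ≤ 1 - Real.exp (-rateTotal m l (1 / Real.exp 1)) := by
  have hcont : ∀ k, IntervalIntegrable
      (fun c => rateDeriv m k c * Real.exp (-rateSum m l L c)) volume 0 (1 / Real.exp 1) :=
    fun k => (continuous_rateDeriv.mul (continuous_rateSum l L).neg.rexp).intervalIntegrable _ _
  have hder : ∀ c, HasDerivAt (fun c => -Real.exp (-rateSum m l L c))
      (∑ k ∈ Finset.Icc l L, rateDeriv m k c * Real.exp (-rateSum m l L c)) c := by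
    intro c
    refine ((hasDerivAt_rateSum (m := m) hl L c).neg.exp.neg).congr_deriv ?_
    rw [← Finset.sum_mul]
    simp [mul_comm]
  have h0 : rateSum m l L 0 = 0 :=
    Finset.sum_eq_zero fun k hk => rate_zero (by have := (Finset.mem_Icc.mp hk).1; omega)
  calc ∑ k ∈ Finset.Icc l L, limitProb m l k
      ≤ ∑ k ∈ Finset.Icc l L, ∫ c in (0 : ℝ)..(1 / Real.exp 1),
          rateDeriv m k c * Real.exp (-rateSum m l L c) :=
        Finset.sum_le_sum fun k _ => limitProb_le_integral hm l L k
    _ = ∫ c in (0 : ℝ)..(1 / Real.exp 1),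
          ∑ k ∈ Finset.Icc l L, rateDeriv m k c * Real.exp (-rateSum m l L c) :=
        (intervalIntegral.integral_finsetSum fun k _ => hcont k).symm
    _ = 1 - Real.exp (-rateSum m l L (1 / Real.exp 1)) := by
        rw [intervalIntegral.integral_eq_sub_of_hasDerivAt (fun c _ => hder c)
          (Continuous.intervalIntegrable (continuous_finsetSum _ fun k _ =>
            continuous_rateDeriv.mul (continuous_rateSum l L).neg.rexp) _ _), h0]
        simp; ring
    _ ≤ _ := by
        have := rateSum_le_rateTotal hm l L (c := 1 / Real.exp 1) (by positivity) le_rfl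
        gcongr

theorem summable_limitProb_and_tsum_lt_one (hm : 0 < m) {l : ℕ} (hl : 0 < l) :
    Summable (fun j => limitProb m l (j + l)) ∧ ∑' j, limitProb m l (j + l) < 1 := by
  have hle : ∀ J, ∑ j ∈ Finset.range J, limitProb m l (j + l) ≤
      1 - Real.exp (-rateTotal m l (1 / Real.exp 1)) := by
    intro J
    refine le_trans ?_ (sum_limitProb_le hm hl (J + l))
    rw [Finset.range_eq_Ico, Finset.sum_Ico_add' (fun k => limitProb m l k)]
    refine Finset.sum_le_sum_of_subset_of_nonneg ?_ fun k _ _ => limitProb_nonneg m l k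
    intro x; simp only [Finset.mem_Icc, Finset.mem_Ico]; omega
  refine ⟨summable_of_sum_range_le (fun j => limitProb_nonneg m l _) hle, ?_⟩
  refine (Real.tsum_le_of_sum_range_le (fun j => limitProb_nonneg m l _) hle).trans_lt ?_
  linarith [Real.exp_pos (-rateTotal m l (1 / Real.exp 1))]

/-- Termwise, `(k * c) ^ k / (k * k!) = k ^ (k - 1) * c ^ k / k!`. -/
theorem treeFunction_eq_tsum_rate (c : ℝ) : treeFunction c = ∑' j, rate 1 (j + 1) c := by
  refine tsum_congr fun j => ?_
  rw [rate, mul_pow, pow_succ ((j + 1 : ℕ) : ℝ) j]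
  have h1 : ((j + 1 : ℕ) : ℝ) ≠ 0 := by positivity
  have h2 : ((j + 1).factorial : ℝ) ≠ 0 := by positivity
  field_simp
  simp

theorem rateTotal_eq_treeFunction {c : ℝ} (h0 : 0 ≤ c) (hc : c ≤ 1 / Real.exp 1) (m l : ℕ) :
    rateTotal m (l + 1) c =
      (treeFunction c - ∑ j ∈ Finset.range l, rate 1 (j + 1) c) / m := by
  have h : ∀ k, rate m k c = rate 1 k c / m := fun k => by
    rw [rate, rate, div_div]; congr 1; push_cast; ring
  rw [treeFunction_eq_tsum_rate,
    ← (summable_rate_add one_pos 1 h0 hc).sum_add_tsum_nat_add l, add_sub_cancel_left, rateTotal,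
    ← tsum_div_const]
  simp only [h, add_assoc]

end Rate

/-! ### Poisson limit for short cycles and first moment for long ones -/

theorem tendsto_descFactorial_div_pow (k : ℕ) :
    Tendsto (fun n : ℕ => (n.descFactorial k : ℝ) / (n : ℝ) ^ k) atTop (𝓝 1) := by
  refine (Asymptotics.isEquivalent_iff_tendsto_one ?_).mp (isEquivalent_descFactorial k)
  filter_upwards [eventually_ne_atTop 0] with n hn
  positivity

namespace CycleModel

variable (M : CycleModel)

/-- The event that the edges in `S` have mean weight at most `x / n`. -/
def light (n : ℕ) (x : ℝ) (S : Finset (M.Edge n)) : Set (M.Edge n → ℝ) :=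
  {w | ∑ e ∈ S, w e ≤ S.card * x / n}

/-- The event that no cycle of length `k ≤ L` has mean weight at most `τ k / n`. -/
def avoid (n L : ℕ) (τ : ℕ → ℝ) : Set (M.Edge n → ℝ) :=
  ⋂ S ∈ M.shortSets n L, (M.light n (τ S.card) S)ᶜ

variable {M} {n : ℕ}

theorem measurableSet_light (x : ℝ) (S : Finset (M.Edge n)) : MeasurableSet (M.light n x S) :=
  measurableSet_le (by fun_prop) measurable_const

theorem measurableSet_avoid (L : ℕ) (τ : ℕ → ℝ) : MeasurableSet (M.avoid n L τ) :=
  Finset.measurableSet_biInter _ fun S _ => (measurableSet_light _ S).compl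

theorem card_cycleSets_eq {k : ℕ} (hk : M.minLen ≤ k) :
    ((M.cycleSets n k).card : ℝ) = n.descFactorial k / (M.mult * k) := by
  have h2 := M.two_le_minLen
  have hk0 : (0 : ℝ) < k := by exact_mod_cast (by omega : 0 < k)
  have hm0 : (0 : ℝ) < M.mult := by exact_mod_cast M.mult_pos
  rw [eq_div_iff (by positivity), ← mult_mul_card_cycleSets hk]
  push_cast; ring

theorem sum_light_le {k : ℕ} (hk : M.minLen ≤ k) {x : ℝ} (hx : 0 ≤ x) :
    ∑ S ∈ M.cycleSets n k, (expWeights (M.Edge n)).real (M.light n x S) ≤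
      (n.descFactorial k / (n : ℝ) ^ k) * rate M.mult k x := by
  calc _ ≤ ∑ S ∈ M.cycleSets n k, (k * x / n) ^ k / (k.factorial : ℝ) := by
        refine Finset.sum_le_sum fun S hS => ?_
        have hc := card_of_mem_cycleSets hk hS
        have := expWeights_real_sum_le S (x := S.card * x / n) (by positivity)
        rw [light, hc]
        rwa [hc] at this
    _ = _ := by
        rw [Finset.sum_const, nsmul_eq_mul, card_cycleSets_eq hk, rate, div_pow]
        field_simp

theorem le_sum_light {k : ℕ} (hk : M.minLen ≤ k) {x : ℝ} (hx : 0 ≤ x) :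
    Real.exp (-(k * x / n)) * ((n.descFactorial k / (n : ℝ) ^ k) * rate M.mult k x) ≤
      ∑ S ∈ M.cycleSets n k, (expWeights (M.Edge n)).real (M.light n x S) := by
  calc _ = ∑ S ∈ M.cycleSets n k,
          Real.exp (-(k * x / n)) * ((k * x / n) ^ k / (k.factorial : ℝ)) := by
        rw [Finset.sum_const, nsmul_eq_mul, card_cycleSets_eq hk, rate, div_pow]
        field_simp
    _ ≤ _ := by
        refine Finset.sum_le_sum fun S hS => ?_
        have hc := card_of_mem_cycleSets hk hS
        have := le_expWeights_real_sum S (x := S.card * x / n) (by positivity)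
        rw [light, hc]
        rwa [hc] at this

variable (M) in
theorem tendsto_sum_light {k : ℕ} (hk : M.minLen ≤ k) {x : ℝ} (hx : 0 ≤ x) :
    Tendsto (fun n => ∑ S ∈ M.cycleSets n k, (expWeights (M.Edge n)).real (M.light n x S))
      atTop (𝓝 (rate M.mult k x)) := by
  have h1 : Tendsto (fun n : ℕ => (n.descFactorial k / (n : ℝ) ^ k) * rate M.mult k x) atTop
      (𝓝 (rate M.mult k x)) := by
    simpa using (tendsto_descFactorial_div_pow k).mul_const (rate M.mult k x)
  have h2 : Tendsto (fun n : ℕ => Real.exp (-(k * x / n))) atTop (𝓝 1) := by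
    have := (tendsto_const_div_atTop_nhds_zero_nat (k * x)).neg.rexp
    simpa using this
  refine tendsto_of_tendsto_of_tendsto_of_le_of_le ?_ h1 (fun n => le_sum_light hk hx)
    fun n => sum_light_le hk hx
  simpa using h2.mul h1

theorem real_avoid_sub_exp_le (L : ℕ) {τ : ℕ → ℝ} {K : ℝ} (hK1 : 1 ≤ K)
    (hK : ∀ k ≤ L, k * τ k ≤ K) (hn : K ≤ n) :
    |(expWeights (M.Edge n)).real (M.avoid n L τ) -
      Real.exp (-∑ S ∈ M.shortSets n L, (expWeights (M.Edge n)).real (M.light n (τ S.card) S))| ≤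
      K / n * ∑ S ∈ M.shortSets n L, (expWeights (M.Edge n)).real (M.light n (τ S.card) S) +
      2 * ((2 * L + 1) * ((2 ^ (2 * L) ^ 2) ^ 2) * K ^ (2 * L + 1) / n) := by
  have hn0 : (0 : ℝ) < n := by linarith
  have hx0 : 0 ≤ K / n := by positivity
  have hx1 : K / n ≤ 1 := (div_le_one hn0).mpr hn
  set μ := expWeights (M.Edge n) with hμ
  set A : Finset (M.Edge n) → Set (M.Edge n → ℝ) := fun S => M.light n (τ S.card) S with hA
  have hshort : ∀ S ∈ M.shortSets n L, 1 ≤ S.card ∧ S.card ≤ L := by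
    intro S hS
    obtain ⟨C, h1, h2, rfl⟩ := mem_shortSets.mp hS
    rw [card_edgeSet h1]
    exact ⟨by have := C.two_le; omega, h2⟩
  have hbd : ∀ S ∈ M.shortSets n L, S.card * τ S.card / n ≤ K / n := fun S hS => by
    have := hK S.card (hshort S hS).2
    gcongr
  have hinter : ∀ S ∈ M.shortSets n L, ∀ T ∈ M.shortSets n L,
      μ.real (A S ∩ A T) ≤ (K / n) ^ (S ∪ T).card := fun S hS T hT =>
    expWeights_real_sum_inter_sum_le S T hx0 (hbd S hS) (hbd T hT)
  have hsingle : ∀ S ∈ M.shortSets n L, μ.real (A S) ≤ (K / n) ^ S.card := fun S hS => by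
    have := hinter S hS S hS
    rwa [Set.inter_self, Finset.union_self] at this
  have hpair : ∀ S ∈ M.shortSets n L, ∀ T ∈ M.shortSets n L,
      μ.real (A S ∩ A T) + μ.real (A S) * μ.real (A T) ≤ 2 * (K / n) ^ (S ∪ T).card := by
    intro S hS T hT
    have h1 : μ.real (A S) * μ.real (A T) ≤ (K / n) ^ (S ∪ T).card := by
      calc _ ≤ (K / n) ^ S.card * (K / n) ^ T.card :=
            mul_le_mul (hsingle S hS) (hsingle T hT) measureReal_nonneg (by positivity)
        _ = (K / n) ^ (S.card + T.card) := (pow_add _ _ _).symm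
        _ ≤ _ := pow_le_pow_of_le_one hx0 hx1 (Finset.card_union_le S T)
    linarith [hinter S hS T hT]
  have hmain := abs_measureReal_iInter_compl_sub_exp_le μ A (fun S => measurableSet_light _ S)
    (fun S T => ¬ Disjoint S T) (fun S U hU => expWeights_real_inter_iInter S U
      (fun T hT => not_not.mp (hU T hT)) fun S => S.card * τ S.card / n) (M.shortSets n L)
  refine hmain.trans (add_le_add ?_ ?_)
  · rw [Finset.mul_sum]
    refine Finset.sum_le_sum fun S hS => ?_
    rw [sq]
    refine mul_le_mul_of_nonneg_right ((hsingle S hS).trans ?_) measureReal_nonneg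
    calc (K / n) ^ S.card ≤ (K / n) ^ 1 := pow_le_pow_of_le_one hx0 hx1 (hshort S hS).1
      _ = K / n := pow_one _
  · refine le_trans ?_ (mul_le_mul_of_nonneg_left (sum_pairs_le (M := M) L hK1 hn) zero_le_two)
    rw [Finset.mul_sum]
    refine Finset.sum_le_sum fun S hS => ?_
    rw [Finset.mul_sum]
    exact Finset.sum_le_sum fun T hT => hpair S hS T (Finset.mem_filter.mp hT).1

variable (M) in
/-- The probability that no short cycle is light converges to that of a Poisson process. -/
theorem tendsto_real_avoid (L : ℕ) {τ : ℕ → ℝ} (hτ : ∀ k, 0 ≤ τ k) :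
    Tendsto (fun n => (expWeights (M.Edge n)).real (M.avoid n L τ)) atTop
      (𝓝 (Real.exp (-∑ k ∈ Finset.Icc M.minLen L, rate M.mult k (τ k)))) := by
  set s : ℕ → ℝ := fun n => ∑ S ∈ M.shortSets n L,
    (expWeights (M.Edge n)).real (M.light n (τ S.card) S) with hs
  have hslim : Tendsto s atTop (𝓝 (∑ k ∈ Finset.Icc M.minLen L, rate M.mult k (τ k))) := by
    simp only [hs, sum_shortSets]
    refine tendsto_finsetSum _ fun k hk => ?_
    have hk' := (Finset.mem_Icc.mp hk).1
    refine (M.tendsto_sum_light hk' (hτ k)).congr fun n => ?_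
    exact Finset.sum_congr rfl fun S hS => by rw [card_of_mem_cycleSets hk' hS]
  -- A common bound for the scaled total weights `k * τ k`; the summand `1` ensures `1 ≤ K`, as the
  -- pair estimate requires.
  set K : ℝ := 1 + ∑ k ∈ Finset.range (L + 1), k * τ k with hK
  have hnn : ∀ k : ℕ, 0 ≤ k * τ k := fun k => mul_nonneg (Nat.cast_nonneg k) (hτ k)
  have hK1 : 1 ≤ K := by
    have : 0 ≤ ∑ k ∈ Finset.range (L + 1), k * τ k := Finset.sum_nonneg fun k _ => hnn k
    linarith
  have hKk : ∀ k ≤ L, k * τ k ≤ K := by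
    intro k hk
    have := Finset.single_le_sum (f := fun k : ℕ => k * τ k) (fun k _ => hnn k)
      (Finset.mem_range.mpr (Nat.lt_succ_of_le hk))
    linarith
  have hbound : Tendsto (fun n : ℕ => K / n * s n +
      2 * ((2 * L + 1) * ((2 ^ (2 * L) ^ 2) ^ 2) * K ^ (2 * L + 1) / n)) atTop (𝓝 0) := by
    have h1 := (tendsto_const_div_atTop_nhds_zero_nat K).mul hslim
    have h2 := (tendsto_const_div_atTop_nhds_zero_nat
      ((2 * L + 1) * ((2 ^ (2 * L) ^ 2) ^ 2) * K ^ (2 * L + 1))).const_mul 2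
    simpa using h1.add h2
  have hdiff : Tendsto (fun n => (expWeights (M.Edge n)).real (M.avoid n L τ) - Real.exp (-s n))
      atTop (𝓝 0) := by
    refine squeeze_zero_norm' ?_ hbound
    filter_upwards [eventually_ge_atTop ⌈K⌉₊] with n hn
    exact real_avoid_sub_exp_le L hK1 hKk (Nat.ceil_le.mp hn)
  have := hdiff.add hslim.neg.rexp
  simpa using this

/-- First moment bound for long light cycles. -/
theorem real_exists_long_light_le (L : ℕ) (hL : M.minLen ≤ L + 1) :
    (expWeights (M.Edge n)).real {w | ∃ C : DirCycle n, L < C.length ∧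
      w ∈ M.light n (1 / Real.exp 1) (M.edgeSet C)} ≤
      ∑' j, rate M.mult (j + (L + 1)) (1 / Real.exp 1) := by
  have he : 0 ≤ 1 / Real.exp 1 := by positivity
  have hlen : ∀ C : DirCycle n, C.length ≤ n := fun C => by
    simpa using Fintype.card_le_of_embedding C.vert
  calc _ ≤ (expWeights (M.Edge n)).real (⋃ j ∈ Finset.range n,
          ⋃ S ∈ M.cycleSets n (j + (L + 1)), M.light n (1 / Real.exp 1) S) := by
        refine measureReal_mono ?_ (measure_ne_top _ _)
        rintro w ⟨C, hC, hw⟩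
        simp only [Set.mem_iUnion]
        refine ⟨C.length - (L + 1), Finset.mem_range.mpr ?_, M.edgeSet C,
          mem_cycleSets.mpr ⟨C, by omega, rfl⟩, hw⟩
        have := hlen C; omega
    _ ≤ ∑ j ∈ Finset.range n, (expWeights (M.Edge n)).real
          (⋃ S ∈ M.cycleSets n (j + (L + 1)), M.light n (1 / Real.exp 1) S) :=
        measureReal_biUnion_finset_le _ _
    _ ≤ ∑ j ∈ Finset.range n, rate M.mult (j + (L + 1)) (1 / Real.exp 1) := by
        refine Finset.sum_le_sum fun j _ => (measureReal_biUnion_finset_le _ _).trans ?_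
        refine (sum_light_le (by omega) he).trans ?_
        -- The falling factorial is at most the power of `n`, so the bound is uniform in `n`, even
        -- for lengths comparable to `n`.
        refine mul_le_of_le_one_left (rate_nonneg he) (div_le_one_of_le₀ ?_ (by positivity))
        exact_mod_cast Nat.descFactorial_le_pow n _
    _ ≤ _ := (summable_rate_add M.mult_pos _ he le_rfl).sum_le_tsum _ fun _ _ => rate_nonneg he

end CycleModel

/-! ### Sandwiching the minimum between avoidance events -/

/-- The threshold `t` for length `k`, and `s` for all other lengths. -/
def twoLevel (k : ℕ) (s t : ℝ) (l : ℕ) : ℝ := if l = k then t else s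

theorem twoLevel_nonneg (k : ℕ) {s t : ℝ} (hs : 0 ≤ s) (ht : 0 ≤ t) (l : ℕ) :
    0 ≤ twoLevel k s t l := by
  unfold twoLevel; split_ifs <;> assumption

theorem sum_rate_twoLevel {m l L k : ℕ} (hk : k ∈ Finset.Icc l L) (s t : ℝ) :
    ∑ j ∈ Finset.Icc l L, rate m j (twoLevel k s t j) =
      rateSum m l L s - rate m k s + rate m k t := by
  rw [rateSum, ← Finset.add_sum_erase _ _ hk, ← Finset.add_sum_erase _ (fun j => rate m j s) hk]
  have h : ∑ j ∈ (Finset.Icc l L).erase k, rate m j (twoLevel k s t j) =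
      ∑ j ∈ (Finset.Icc l L).erase k, rate m j s :=
    Finset.sum_congr rfl fun j hj => by
      rw [twoLevel, if_neg (Finset.ne_of_mem_erase hj)]
  rw [h, twoLevel, if_pos rfl]
  ring

namespace CycleModel

variable (M : CycleModel) {n : ℕ}

/-- The mean weight of a cycle. -/
noncomputable def mean (C : DirCycle n) (w : M.Edge n → ℝ) : ℝ :=
  (∑ e ∈ M.edgeSet C, w e) / C.length

/-- `C` has the smallest mean weight of all cycles of the model. -/
def IsMin (C : DirCycle n) (w : M.Edge n → ℝ) : Prop :=
  ∀ C' : DirCycle n, M.minLen ≤ C'.length → M.mean C w ≤ M.mean C' w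

/-- The event that a cycle of smallest mean weight has length `k`. -/
def minEvent (n k : ℕ) : Set (M.Edge n → ℝ) :=
  {w | ∃ C : DirCycle n, M.IsMin C w ∧ C.length = k}

/-- The event that a cycle of smallest mean weight has length `k` and mean weight at most
`1 / (e n)`. -/
def lightMinEvent (n k : ℕ) : Set (M.Edge n → ℝ) :=
  {w | ∃ C : DirCycle n, M.IsMin C w ∧ C.length = k ∧ M.mean C w ≤ 1 / (Real.exp 1 * n)}

variable {M}

theorem mem_light_iff {C : DirCycle n} (hC : M.minLen ≤ C.length) {x : ℝ} {w : M.Edge n → ℝ} :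
    w ∈ M.light n x (M.edgeSet C) ↔ M.mean C w ≤ x / n := by
  have : (0 : ℝ) < C.length := by
    have := C.two_le
    exact_mod_cast (by omega : 0 < C.length)
  rw [light, Set.mem_ofPred_eq, card_edgeSet hC, mean, div_le_iff₀ this]
  constructor <;> intro h <;> refine h.trans (le_of_eq ?_) <;> ring

theorem mem_avoid_iff {L : ℕ} {τ : ℕ → ℝ} {w : M.Edge n → ℝ} :
    w ∈ M.avoid n L τ ↔ ∀ C : DirCycle n, M.minLen ≤ C.length → C.length ≤ L →
      τ C.length / n < M.mean C w := by
  simp only [avoid, Set.mem_iInter, Set.mem_compl_iff, mem_shortSets]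
  constructor
  · intro h C h1 h2
    have := h _ ⟨C, h1, h2, rfl⟩
    rwa [mem_light_iff h1, card_edgeSet h1, not_le] at this
  · rintro h S ⟨C, h1, h2, rfl⟩
    rw [mem_light_iff h1, card_edgeSet h1, not_le]
    exact h C h1 h2

theorem avoid_subset_avoid {L : ℕ} {τ τ' : ℕ → ℝ} (h : ∀ k, τ k ≤ τ' k) :
    M.avoid n L τ' ⊆ M.avoid n L τ := by
  intro w hw
  rw [mem_avoid_iff] at hw ⊢
  intro C h1 h2
  refine lt_of_le_of_lt ?_ (hw C h1 h2)
  have := h C.length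
  gcongr

theorem twoLevel_mono {k : ℕ} {s t t' : ℝ} (h : t ≤ t') (l : ℕ) :
    twoLevel k s t l ≤ twoLevel k s t' l := by
  unfold twoLevel; split_ifs <;> simp [h]

theorem lightMinEvent_subset_minEvent (n k : ℕ) : M.lightMinEvent n k ⊆ M.minEvent n k :=
  fun _ ⟨C, h1, h2, _⟩ => ⟨C, h1, h2⟩

variable (M) in
/-- The limit of `tendsto_real_avoid` for a two-level threshold, as a product. -/
theorem tendsto_real_avoid_twoLevel {L k : ℕ} (hk : k ∈ Finset.Icc M.minLen L) {s t : ℝ}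
    (hs : 0 ≤ s) (ht : 0 ≤ t) :
    Tendsto (fun n => (expWeights (M.Edge n)).real (M.avoid n L (twoLevel k s t))) atTop
      (𝓝 (Real.exp (-(rateSum M.mult M.minLen L s - rate M.mult k s)) *
        Real.exp (-rate M.mult k t))) := by
  have := M.tendsto_real_avoid L (twoLevel_nonneg k hs ht)
  rwa [sum_rate_twoLevel hk, neg_add, Real.exp_add] at this

/-- The Riemann–Stieltjes sums behind both bounds. -/
theorem exists_partition {m l L k : ℕ} (hk : k ≠ 0) {b : ℝ} (hb : 0 ≤ b) {ε : ℝ} (hε : 0 < ε) :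
    ∃ (N : ℕ) (t : ℕ → ℝ), t 0 = 0 ∧ t N = b ∧ Monotone t ∧
      |∑ i ∈ Finset.range N, Real.exp (-(rateSum m l L (t i) - rate m k (t i))) *
          (Real.exp (-rate m k (t i)) - Real.exp (-rate m k (t (i + 1)))) -
        ∫ c in (0 : ℝ)..b, rateDeriv m k c * Real.exp (-rateSum m l L c)| ≤ ε ∧
      |∑ i ∈ Finset.range N, Real.exp (-(rateSum m l L (t (i + 1)) - rate m k (t (i + 1)))) *
          (Real.exp (-rate m k (t i)) - Real.exp (-rate m k (t (i + 1)))) -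
        ∫ c in (0 : ℝ)..b, rateDeriv m k c * Real.exp (-rateSum m l L c)| ≤ ε := by
  -- The factor for the lengths other than `k` is integrated against the increments of `-exp (-rate
  -- m k c)`, the distribution of the lowest level of a cycle of length `k` up to a constant.
  have h := exists_riemannStieltjes_sum_close
    (f := fun c => Real.exp (-(rateSum m l L c - rate m k c)))
    (H := fun c => -Real.exp (-rate m k c))
    (h := fun c => rateDeriv m k c * Real.exp (-rate m k c)) hb
    ((continuous_rateSum l L).sub continuous_rate).neg.rexp
    (continuous_rateDeriv.mul continuous_rate.neg.rexp)
    (fun c => ((hasDerivAt_rate hk c).neg.exp.neg).congr_deriv (by simp; ring))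
    (fun c hc => mul_nonneg (rateDeriv_nonneg hc) (Real.exp_pos _).le) hε
  have e : ∀ c, Real.exp (-(rateSum m l L c - rate m k c)) *
      (rateDeriv m k c * Real.exp (-rate m k c)) =
      rateDeriv m k c * Real.exp (-rateSum m l L c) := by
    intro c
    rw [mul_left_comm, ← Real.exp_add]
    ring_nf
  simpa only [e, neg_sub_neg] using h

/-- Locate the minimum at the first grid point not below its level: no short cycle is below the
preceding point, while a cycle of length `k` reaches this one. The exceptional cases are a minimum
above the last point or a nonpositive one. -/
theorem minEvent_subset {L k N : ℕ} (hkl : M.minLen ≤ k) (hkL : k ≤ L) {t : ℕ → ℝ}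
    (ht0 : t 0 = 0) :
    M.minEvent n k ⊆ (M.avoid n L (twoLevel k (t N) (t N)) ∪
      (M.avoid n L (twoLevel k 0 0))ᶜ) ∪ ⋃ i ∈ Finset.range N,
        (M.avoid n L (twoLevel k (t i) (t i)) \ M.avoid n L (twoLevel k (t i) (t (i + 1)))) := by
  rintro w ⟨C, hC, rfl⟩
  have two : ∀ s l, twoLevel C.length s s l = s := fun s l => by simp [twoLevel]
  have hav : ∀ s, s / n < M.mean C w → w ∈ M.avoid n L (twoLevel C.length s s) := by
    intro s hs
    rw [mem_avoid_iff]
    intro C' h1 _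
    rw [two]
    exact hs.trans_le (hC C' h1)
  by_cases hN : t N / n < M.mean C w
  · exact Or.inl (Or.inl (hav _ hN))
  by_cases h0 : M.mean C w ≤ 0
  · refine Or.inl (Or.inr fun h => ?_)
    have := mem_avoid_iff.mp h C hkl hkL
    rw [two, zero_div] at this
    exact absurd h0 (not_le.mpr this)
  right
  classical
  have hex : ∃ i, M.mean C w ≤ t i / n := ⟨N, not_lt.mp hN⟩
  have hspec := Nat.find_spec hex
  have hmin := fun {i} => Nat.find_min (m := i) hex
  have hle : Nat.find hex ≤ N := Nat.find_min' hex (not_lt.mp hN)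
  obtain ⟨i, hi⟩ : ∃ i, Nat.find hex = i + 1 := by
    refine Nat.exists_eq_succ_of_ne_zero fun h => h0 ?_
    rw [h, ht0, zero_div] at hspec
    exact hspec
  rw [hi] at hspec hle
  simp only [Set.mem_iUnion]
  refine ⟨i, Finset.mem_range.mpr hle, hav _ (not_le.mp (hmin (by omega))), fun h => ?_⟩
  have := mem_avoid_iff.mp h C hkl hkL
  rw [twoLevel, if_pos rfl] at this
  exact absurd hspec (not_le.mpr this)

variable (M) in
theorem eventually_real_minEvent_le {L k : ℕ} (hkl : M.minLen ≤ k) (hkL : k ≤ L) {b : ℝ}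
    (hb : 0 ≤ b) {ε : ℝ} (hε : 0 < ε) :
    ∀ᶠ n in atTop, (expWeights (M.Edge n)).real (M.minEvent n k) ≤
      (∫ c in (0 : ℝ)..b, rateDeriv M.mult k c * Real.exp (-rateSum M.mult M.minLen L c)) +
        Real.exp (-rateSum M.mult M.minLen L b) + ε := by
  have hk : k ∈ Finset.Icc M.minLen L := Finset.mem_Icc.mpr ⟨hkl, hkL⟩
  have hk0 : k ≠ 0 := by have := M.two_le_minLen; omega
  obtain ⟨N, t, ht0, htN, htm, hsum, -⟩ :=
    exists_partition (m := M.mult) (l := M.minLen) (L := L) hk0 hb (half_pos hε)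
  have htnn : ∀ i, 0 ≤ t i := fun i => ht0 ▸ htm (Nat.zero_le i)
  have hlim : Tendsto (fun n => (expWeights (M.Edge n)).real (M.avoid n L (twoLevel k (t N) (t N)))
      + (1 - (expWeights (M.Edge n)).real (M.avoid n L (twoLevel k 0 0))) +
      ∑ i ∈ Finset.range N, ((expWeights (M.Edge n)).real (M.avoid n L (twoLevel k (t i) (t i))) -
        (expWeights (M.Edge n)).real (M.avoid n L (twoLevel k (t i) (t (i + 1)))))) atTop
      (𝓝 (Real.exp (-rateSum M.mult M.minLen L b) + (1 - 1) + ∑ i ∈ Finset.range N,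
        Real.exp (-(rateSum M.mult M.minLen L (t i) - rate M.mult k (t i))) *
          (Real.exp (-rate M.mult k (t i)) - Real.exp (-rate M.mult k (t (i + 1)))))) := by
    refine (Tendsto.add ?_ (tendsto_const_nhds.sub ?_)).add (tendsto_finsetSum _ fun i _ => ?_)
    · convert M.tendsto_real_avoid_twoLevel hk (htnn N) (htnn N) using 2
      rw [← Real.exp_add, htN]
      ring_nf
    -- All rates vanish at level `0`, so nonpositive short cycles have vanishing probability.
    · convert M.tendsto_real_avoid_twoLevel hk le_rfl le_rfl using 2
      have : rateSum M.mult M.minLen L 0 = 0 := Finset.sum_eq_zero fun j hj => rate_zero (by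
        have := M.two_le_minLen
        have := (Finset.mem_Icc.mp hj).1
        omega)
      simp [this, rate_zero hk0]
    · rw [mul_sub]
      exact (M.tendsto_real_avoid_twoLevel hk (htnn i) (htnn i)).sub
        (M.tendsto_real_avoid_twoLevel hk (htnn i) (htnn (i + 1)))
  have hlt : Real.exp (-rateSum M.mult M.minLen L b) + (1 - 1) + ∑ i ∈ Finset.range N,
        Real.exp (-(rateSum M.mult M.minLen L (t i) - rate M.mult k (t i))) *
          (Real.exp (-rate M.mult k (t i)) - Real.exp (-rate M.mult k (t (i + 1)))) <
      (∫ c in (0 : ℝ)..b, rateDeriv M.mult k c * Real.exp (-rateSum M.mult M.minLen L c)) +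
        Real.exp (-rateSum M.mult M.minLen L b) + ε := by
    linarith [(abs_le.mp hsum).2]
  filter_upwards [hlim.eventually_lt_const hlt] with n hn
  refine le_trans ?_ hn.le
  refine (measureReal_mono (minEvent_subset (N := N) hkl hkL ht0) (measure_ne_top _ _)).trans ?_
  refine (measureReal_union_le _ _).trans (add_le_add ((measureReal_union_le _ _).trans ?_) ?_)
  · rw [probReal_compl_eq_one_sub (measurableSet_avoid _ _)]
  · refine (measureReal_biUnion_finset_le _ _).trans (Finset.sum_le_sum fun i _ => ?_)
    rw [measureReal_sdiff (avoid_subset_avoid (twoLevel_mono (htm (Nat.le_succ i))))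
      (measurableSet_avoid _ _)]

/-- Some short cycle has level at most `s`, while every cycle of another length is above `s`, the
long ones because `s ≤ 1 / e`. The lightest cycle of length `k` is therefore the global minimum. -/
theorem exists_isMin_of_mem {L k : ℕ} {w : M.Edge n → ℝ} {s x : ℝ} (hkl : M.minLen ≤ k)
    (hs : s ≤ 1 / Real.exp 1)
    (h1 : w ∈ M.avoid n L (twoLevel k s x)) (h2 : w ∉ M.avoid n L (twoLevel k s s))
    (h3 : ∀ C : DirCycle n, L < C.length → w ∉ M.light n (1 / Real.exp 1) (M.edgeSet C)) :
    w ∈ M.lightMinEvent n k := by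
  rw [mem_avoid_iff] at h1 h2
  push Not at h2
  obtain ⟨C, hC1, hC2, hC3⟩ := h2
  have two : ∀ s l, twoLevel k s s l = s := fun s l => by simp [twoLevel]
  rw [two] at hC3
  have hother : ∀ C' : DirCycle n, M.minLen ≤ C'.length → C'.length ≠ k →
      s / n < M.mean C' w := by
    intro C' h hne
    rcases le_or_gt C'.length L with hL | hL
    · have := h1 C' h hL
      rwa [twoLevel, if_neg hne] at this
    · have := h3 C' hL
      rw [mem_light_iff h, not_le] at this
      refine lt_of_le_of_lt ?_ this
      gcongr
  have hlen : C.length = k := by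
    by_contra hne
    exact absurd hC3 (not_le.mpr (hother C hC1 hne))
  obtain ⟨l, hl2, v⟩ := C
  obtain rfl : l = k := hlen
  obtain ⟨v₀, -, hv₀⟩ := Finset.exists_min_image (Finset.univ : Finset (Fin l ↪ Fin n))
    (fun v => M.mean ⟨l, hl2, v⟩ w) ⟨v, Finset.mem_univ v⟩
  have hv₀s : M.mean ⟨l, hl2, v₀⟩ w ≤ s / n := (hv₀ v (Finset.mem_univ v)).trans hC3
  refine ⟨⟨l, hl2, v₀⟩, fun C' hC' => ?_, rfl, hv₀s.trans ?_⟩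
  · by_cases hne : C'.length = l
    · obtain ⟨l', hl', v'⟩ := C'
      obtain rfl : l' = l := hne
      exact hv₀ v' (Finset.mem_univ v')
    · exact hv₀s.trans (hother C' hC' hne).le
  · rw [← div_div]
    gcongr

variable (M) in
theorem eventually_le_real_lightMinEvent {L k : ℕ} (hkl : M.minLen ≤ k) (hkL : k ≤ L) {ε : ℝ}
    (hε : 0 < ε) :
    ∀ᶠ n in atTop, (∫ c in (0 : ℝ)..(1 / Real.exp 1),
        rateDeriv M.mult k c * Real.exp (-rateSum M.mult M.minLen L c)) -
        ∑' j, rate M.mult (j + (L + 1)) (1 / Real.exp 1) - ε ≤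
      (expWeights (M.Edge n)).real (M.lightMinEvent n k) := by
  have hk : k ∈ Finset.Icc M.minLen L := Finset.mem_Icc.mpr ⟨hkl, hkL⟩
  have hk0 : k ≠ 0 := by have := M.two_le_minLen; omega
  obtain ⟨N, t, ht0, htN, htm, -, hsum⟩ := exists_partition (m := M.mult) (l := M.minLen) (L := L)
    hk0 (b := 1 / Real.exp 1) (by positivity) (half_pos hε)
  have htnn : ∀ i, 0 ≤ t i := fun i => ht0 ▸ htm (Nat.zero_le i)
  have hlim : Tendsto (fun n => ∑ i ∈ Finset.range N,
      ((expWeights (M.Edge n)).real (M.avoid n L (twoLevel k (t (i + 1)) (t i))) -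
        (expWeights (M.Edge n)).real (M.avoid n L (twoLevel k (t (i + 1)) (t (i + 1)))))) atTop
      (𝓝 (∑ i ∈ Finset.range N,
        Real.exp (-(rateSum M.mult M.minLen L (t (i + 1)) - rate M.mult k (t (i + 1)))) *
          (Real.exp (-rate M.mult k (t i)) - Real.exp (-rate M.mult k (t (i + 1)))))) := by
    refine tendsto_finsetSum _ fun i _ => ?_
    rw [mul_sub]
    exact (M.tendsto_real_avoid_twoLevel hk (htnn (i + 1)) (htnn i)).sub
      (M.tendsto_real_avoid_twoLevel hk (htnn (i + 1)) (htnn (i + 1)))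
  have hlt : (∫ c in (0 : ℝ)..(1 / Real.exp 1),
        rateDeriv M.mult k c * Real.exp (-rateSum M.mult M.minLen L c)) - ε <
      ∑ i ∈ Finset.range N,
        Real.exp (-(rateSum M.mult M.minLen L (t (i + 1)) - rate M.mult k (t (i + 1)))) *
          (Real.exp (-rate M.mult k (t i)) - Real.exp (-rate M.mult k (t (i + 1)))) := by
    linarith [(abs_le.mp hsum).1]
  filter_upwards [hlim.eventually_const_lt hlt] with n hn
  set μ := expWeights (M.Edge n)
  -- On `D i` the lightest cycle of length `k` has level in `(t i, t (i + 1)]` and all other short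
  -- lengths stay above `t (i + 1)`. These events are disjoint, so their probabilities add up to the
  -- right Riemann–Stieltjes sum.
  set D : ℕ → Set (M.Edge n → ℝ) := fun i =>
    M.avoid n L (twoLevel k (t (i + 1)) (t i)) \
      M.avoid n L (twoLevel k (t (i + 1)) (t (i + 1))) with hD
  set F : Set (M.Edge n → ℝ) := {w | ∃ C : DirCycle n, L < C.length ∧
      w ∈ M.light n (1 / Real.exp 1) (M.edgeSet C)} with hF
  have hsumD : ∑ i ∈ Finset.range N, (μ.real (M.avoid n L (twoLevel k (t (i + 1)) (t i))) -
        μ.real (M.avoid n L (twoLevel k (t (i + 1)) (t (i + 1))))) =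
      ∑ i ∈ Finset.range N, μ.real (D i) :=
    Finset.sum_congr rfl fun i _ => (measureReal_sdiff
      (avoid_subset_avoid (twoLevel_mono (htm (Nat.le_succ i)))) (measurableSet_avoid _ _)).symm
  have hdis : ∀ i j, i < j → Disjoint (D i) (D j) := by
    intro i j hij
    refine Set.disjoint_left.mpr fun w hi hj => hi.2 ?_
    have h1 := mem_avoid_iff.mp hi.1
    have h2 := mem_avoid_iff.mp hj.1
    refine mem_avoid_iff.mpr fun C hC1 hC2 => ?_
    have h1 := h1 C hC1 hC2
    have h2 := h2 C hC1 hC2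
    unfold twoLevel at *
    split_ifs at * with hl
    · refine lt_of_le_of_lt ?_ h2
      have : t (i + 1) ≤ t j := htm hij
      gcongr
    · exact h1
  have hunion : μ.real (⋃ i ∈ Finset.range N, D i) = ∑ i ∈ Finset.range N, μ.real (D i) := by
    refine measureReal_biUnion_finset ?_ fun i _ =>
      (measurableSet_avoid _ _).diff (measurableSet_avoid _ _)
    intro i _ j _ hij
    rcases lt_or_gt_of_ne hij with h | h
    · exact hdis i j h
    · exact (hdis j i h).symm
  have hsub : (⋃ i ∈ Finset.range N, D i) ⊆ M.lightMinEvent n k ∪ F := by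
    intro w hw
    simp only [Set.mem_iUnion] at hw
    obtain ⟨i, hi, hw⟩ := hw
    by_cases hwF : w ∈ F
    · exact Or.inr hwF
    · refine Or.inl (exists_isMin_of_mem hkl ?_ hw.1 hw.2 fun C hC h => hwF ⟨C, hC, h⟩)
      exact htN ▸ htm (Finset.mem_range.mp hi)
  have hle := (measureReal_mono (μ := μ) hsub (measure_ne_top _ _)).trans
    (measureReal_union_le _ _)
  have hFle : μ.real F ≤ _ := real_exists_long_light_le (M := M) (n := n) L (by omega)
  rw [hunion, ← hsumD] at hle
  linarith

variable (M) in
theorem eventually_limitProb_sub_lt {k : ℕ} (hkl : M.minLen ≤ k) {ε : ℝ} (hε : 0 < ε) :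
    ∀ᶠ n in atTop, limitProb M.mult M.minLen k - ε <
      (expWeights (M.Edge n)).real (M.lightMinEvent n k) := by
  obtain ⟨L, hL1, hL2⟩ := ((tendsto_tsum_rate_tail M.mult).eventually_lt_const
    (half_pos hε) |>.and (eventually_ge_atTop k)).exists
  filter_upwards [M.eventually_le_real_lightMinEvent hkl hL2 (ε := ε / 4) (by positivity)]
    with n hn
  linarith [limitProb_le_integral M.mult_pos M.minLen L k]

variable (M) in
theorem eventually_lt_limitProb_add {k : ℕ} (hkl : M.minLen ≤ k) {ε : ℝ} (hε : 0 < ε) :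
    ∀ᶠ n in atTop, (expWeights (M.Edge n)).real (M.minEvent n k) <
      limitProb M.mult M.minLen k + ε := by
  have hk0 : k ≠ 0 := by have := M.two_le_minLen; omega
  set c₀ := 1 / Real.exp 1 with hc₀
  have hc₀0 : 0 < c₀ := by positivity
  -- The order of choices matters: `b > 1 / e` is fixed first, by continuity of the rate of length
  -- `k`. Only then is `L` taken large, so that `exp (-rateSum)` at `b` and the truncation error are
  -- both small.
  obtain ⟨b, hb1, hb2⟩ : ∃ b, c₀ < b ∧ rate M.mult k b < rate M.mult k c₀ + ε / 5 := by
    have h1 : ∀ᶠ b in 𝓝[>] c₀, rate M.mult k b < rate M.mult k c₀ + ε / 5 :=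
      (continuous_rate.tendsto c₀).mono_left nhdsWithin_le_nhds |>.eventually_lt_const
        (by linarith)
    obtain ⟨b, h2, h3⟩ := (h1.and self_mem_nhdsWithin).exists
    exact ⟨b, h3, h2⟩
  have ht1 : Tendsto (fun L => rate M.mult k c₀ * ∑' j, rate M.mult (j + (L + 1)) c₀) atTop
      (𝓝 0) := by
    have := (tendsto_tsum_rate_tail M.mult).const_mul (rate M.mult k c₀)
    rwa [mul_zero] at this
  have ht2 : Tendsto (fun L => Real.exp (-rateSum M.mult M.minLen L b)) atTop (𝓝 0) :=
    Real.tendsto_exp_neg_atTop_nhds_zero.comp (tendsto_rateSum_atTop M.mult_pos _ hb1)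
  have hε5 : 0 < ε / 5 := by positivity
  obtain ⟨L, ⟨hL1, hL2⟩, hL3⟩ := ((ht1.eventually_lt_const hε5).and
    (ht2.eventually_lt_const hε5) |>.and (eventually_ge_atTop k)).exists
  filter_upwards [M.eventually_real_minEvent_le hkl hL3 (hc₀0.trans hb1).le hε5] with n hn
  have hint : ∀ x y, IntervalIntegrable
      (fun c => rateDeriv M.mult k c * Real.exp (-rateSum M.mult M.minLen L c)) volume x y :=
    fun x y => (continuous_rateDeriv.mul (continuous_rateSum _ L).neg.rexp).intervalIntegrable x y
  have hsplit := intervalIntegral.integral_add_adjacent_intervals (hint 0 c₀) (hint c₀ b)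
  have hright : (∫ c in c₀..b, rateDeriv M.mult k c *
      Real.exp (-rateSum M.mult M.minLen L c)) ≤ rate M.mult k b - rate M.mult k c₀ := by
    rw [← intervalIntegral.integral_eq_sub_of_hasDerivAt (fun c _ => hasDerivAt_rate hk0 c)
      (continuous_rateDeriv.intervalIntegrable _ _)]
    refine intervalIntegral.integral_mono_on hb1.le (hint _ _)
      (continuous_rateDeriv.intervalIntegrable _ _) fun c hc => ?_
    have hc0 : 0 ≤ c := hc₀0.le.trans hc.1
    refine mul_le_of_le_one_right (rateDeriv_nonneg hc0) (Real.exp_le_one_iff.mpr ?_)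
    linarith [rateSum_nonneg (m := M.mult) M.minLen L hc0]
  have hleft := integral_sub_limitProb_le M.mult_pos (hkl.trans hL3) hk0
  linarith

variable (M) in
theorem tendsto_real_events {k : ℕ} (hkl : M.minLen ≤ k) :
    Tendsto (fun n => (expWeights (M.Edge n)).real (M.minEvent n k)) atTop
        (𝓝 (limitProb M.mult M.minLen k)) ∧
      Tendsto (fun n => (expWeights (M.Edge n)).real (M.lightMinEvent n k)) atTop
        (𝓝 (limitProb M.mult M.minLen k)) := by
  have hmono : ∀ n, (expWeights (M.Edge n)).real (M.lightMinEvent n k) ≤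
      (expWeights (M.Edge n)).real (M.minEvent n k) := fun n =>
    measureReal_mono (lightMinEvent_subset_minEvent n k)
  constructor <;> refine tendsto_order.mpr ⟨fun x hx => ?_, fun x hx => ?_⟩
  · filter_upwards [M.eventually_limitProb_sub_lt hkl (sub_pos.mpr hx)] with n hn
    linarith [hmono n]
  · filter_upwards [M.eventually_lt_limitProb_add hkl (sub_pos.mpr hx)] with n hn
    linarith
  · filter_upwards [M.eventually_limitProb_sub_lt hkl (sub_pos.mpr hx)] with n hn
    linarith
  · filter_upwards [M.eventually_lt_limitProb_add hkl (sub_pos.mpr hx)] with n hn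
    linarith [hmono n]

end CycleModel

/-! ### Specialisation to directed and undirected graphs -/

theorem dirModel_mean {n : ℕ} (C : DirCycle n) (w : Arc n → ℝ) :
    dirModel.mean C w = C.meanWeight w := by
  have hC : dirModel.minLen ≤ C.length := C.two_le
  exact congrArg (· / (C.length : ℝ)) (Finset.sum_image (dirModel.edge_injective C hC).injOn)

theorem dirModel_isMin_iff {n : ℕ} (C : DirCycle n) (w : Arc n → ℝ) :
    dirModel.IsMin C w ↔ C.IsMinMean w := by
  unfold CycleModel.IsMin DirCycle.IsMinMean
  refine forall_congr' fun C' => ?_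
  rw [← dirModel_mean, ← dirModel_mean]
  exact ⟨fun h => h C'.two_le, fun h _ => h⟩

theorem dirModel_minEvent (n k : ℕ) :
    dirModel.minEvent n k = {w | ∃ C : DirCycle n, C.IsMinMean w ∧ C.length = k} :=
  Set.ext fun w => exists_congr fun C => and_congr_left' (dirModel_isMin_iff C w)

theorem dirModel_lightMinEvent (n k : ℕ) :
    dirModel.lightMinEvent n k = {w | ∃ C : DirCycle n, C.IsMinMean w ∧ C.length = k ∧
      C.meanWeight w ≤ 1 / (Real.exp 1 * n)} :=
  Set.ext fun w => exists_congr fun C => and_congr (dirModel_isMin_iff C w)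
    (and_congr_right' (dirModel_mean C w ▸ Iff.rfl))

/-- An undirected cycle with its orientation. -/
def UndirCycle.toDir {n : ℕ} (C : UndirCycle n) : DirCycle n :=
  ⟨C.length, le_trans (by norm_num) C.three_le, C.vert⟩

theorem UndirCycle.exists_toDir_eq {n : ℕ} (C : DirCycle n) (hC : 3 ≤ C.length) :
    ∃ C' : UndirCycle n, C'.toDir = C := ⟨⟨C.length, hC, C.vert⟩, rfl⟩

theorem undirModel_mean {n : ℕ} (C : UndirCycle n) (w : UEdge n → ℝ) :
    undirModel.mean C.toDir w = C.meanWeight w := by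
  have hC : undirModel.minLen ≤ C.toDir.length := C.three_le
  exact congrArg (· / (C.length : ℝ))
    (Finset.sum_image (undirModel.edge_injective C.toDir hC).injOn)

theorem undirModel_isMin_iff {n : ℕ} (C : UndirCycle n) (w : UEdge n → ℝ) :
    undirModel.IsMin C.toDir w ↔ C.IsMinMean w := by
  unfold CycleModel.IsMin UndirCycle.IsMinMean
  constructor
  · intro h C'
    rw [← undirModel_mean, ← undirModel_mean]
    exact h C'.toDir C'.three_le
  · intro h C' hC'
    obtain ⟨C'', rfl⟩ := UndirCycle.exists_toDir_eq C' hC'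
    rw [undirModel_mean, undirModel_mean]
    exact h C''

theorem undirModel_minEvent (n : ℕ) {k : ℕ} (hk : 3 ≤ k) :
    undirModel.minEvent n k = {w | ∃ C : UndirCycle n, C.IsMinMean w ∧ C.length = k} := by
  ext w
  constructor
  · rintro ⟨C, h1, h2⟩
    obtain ⟨C', rfl⟩ := UndirCycle.exists_toDir_eq C (h2 ▸ hk)
    exact ⟨C', (undirModel_isMin_iff C' w).mp h1, h2⟩
  · rintro ⟨C, h1, h2⟩
    exact ⟨C.toDir, (undirModel_isMin_iff C w).mpr h1, h2⟩

theorem undirModel_lightMinEvent (n : ℕ) {k : ℕ} (hk : 3 ≤ k) :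
    undirModel.lightMinEvent n k = {w | ∃ C : UndirCycle n, C.IsMinMean w ∧ C.length = k ∧
      C.meanWeight w ≤ 1 / (Real.exp 1 * n)} := by
  ext w
  constructor
  · rintro ⟨C, h1, h2, h3⟩
    obtain ⟨C', rfl⟩ := UndirCycle.exists_toDir_eq C (h2 ▸ hk)
    exact ⟨C', (undirModel_isMin_iff C' w).mp h1, h2, undirModel_mean C' w ▸ h3⟩
  · rintro ⟨C, h1, h2, h3⟩
    exact ⟨C.toDir, (undirModel_isMin_iff C w).mpr h1, h2, undirModel_mean C w ▸ h3⟩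

/-- The only missing length is `1`, whose term in the tree series is `c`. -/
theorem limitProb_dir (k : ℕ) : limitProb 1 2 k = pDir k := by
  refine intervalIntegral.integral_congr fun c hc => ?_
  rw [Set.uIcc_of_le (by positivity)] at hc
  simp only [rateDeriv, rateTotal_eq_treeFunction hc.1 hc.2 1 1, Finset.sum_range_one]
  simp only [rate, Nat.cast_one, zero_add, Nat.factorial_one, one_mul, mul_one, pow_one, div_one,
    neg_sub, neg_add_eq_sub]

/-- The missing lengths `1` and `2` have the terms `c` and `c ^ 2`; the factor `1 / 2` in the
exponent accounts for orientation. -/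
theorem limitProb_undir (k : ℕ) : limitProb 2 3 k = pUndir k := by
  refine intervalIntegral.integral_congr fun c hc => ?_
  rw [Set.uIcc_of_le (by positivity)] at hc
  simp only [rateDeriv, rateTotal_eq_treeFunction hc.1 hc.2 2 2, Finset.sum_range_succ,
    Finset.sum_range_zero]
  congr 2
  simp only [rate, Nat.factorial]
  push_cast
  ring

theorem mainTheorem2 :
    -- the complete directed graph
    ((∀ k : ℕ, 2 ≤ k →
        Tendsto (fun n : ℕ => (expWeights (Arc n)).real
            {w | ∃ C : DirCycle n, C.IsMinMean w ∧ C.length = k})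
          atTop (𝓝 (pDir k)) ∧
        Tendsto (fun n : ℕ => (expWeights (Arc n)).real
            {w | ∃ C : DirCycle n, C.IsMinMean w ∧ C.length = k ∧
              C.meanWeight w ≤ 1 / (Real.exp 1 * n)})
          atTop (𝓝 (pDir k))) ∧
      Summable (fun j : ℕ => pDir (j + 2)) ∧ ∑' j : ℕ, pDir (j + 2) < 1) ∧
    -- the complete undirected graph
    ((∀ k : ℕ, 3 ≤ k →
        Tendsto (fun n : ℕ => (expWeights (UEdge n)).real
            {w | ∃ C : UndirCycle n, C.IsMinMean w ∧ C.length = k})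
          atTop (𝓝 (pUndir k)) ∧
        Tendsto (fun n : ℕ => (expWeights (UEdge n)).real
            {w | ∃ C : UndirCycle n, C.IsMinMean w ∧ C.length = k ∧
              C.meanWeight w ≤ 1 / (Real.exp 1 * n)})
          atTop (𝓝 (pUndir k))) ∧
      Summable (fun j : ℕ => pUndir (j + 3)) ∧ ∑' j : ℕ, pUndir (j + 3) < 1) := by
  refine ⟨⟨fun k hk => ?_, ?_⟩, fun k hk => ?_, ?_⟩
  · rw [← limitProb_dir]
    simp only [← dirModel_minEvent, ← dirModel_lightMinEvent]
    exact dirModel.tendsto_real_events hk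
  · simp only [← limitProb_dir]
    exact summable_limitProb_and_tsum_lt_one one_pos two_pos
  · rw [← limitProb_undir]
    simp only [← undirModel_minEvent _ hk, ← undirModel_lightMinEvent _ hk]
    exact undirModel.tendsto_real_events hk
  · simp only [← limitProb_undir]
    exact summable_limitProb_and_tsum_lt_one two_pos three_pos
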